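/- Let $G$ be a penny graph with vertices in general position, that is, a finite graph whose vertices are points of the Euclidean plane, no three of them collinear and every two of them at distance at least $1$, and whose edges are exactly the pairs of vertices at distance $1$. Call a vertex of $G$ popular if it has degree $5$, at most one of its neighbors has degree $4$, and all its other neighbors have degree $5$; otherwise call it unpopular. A kernel is a quadruple of distinct vertices $L, U, R, D$ of $G$, each of degree $5$, such that $LU$, $UR$, $RD$, $DL$ and $LR$ are edges. Then every vertex of degree $4$ in $G$ has an unpopular neighbor that does not belong to any kernel. -/

import Mathlib

/-- The Euclidean plane. -/
abbrev Plane : Type := EuclideanSpace ℝ (Fin 2)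

/-- `G`, drawn with its vertices at the points `p v`, is a penny graph: any two distinct vertices
are at distance at least `1`, and the edges are exactly the pairs at distance `1`.
(Distinct vertices then lie at distinct points, and the unit segments representing the edges
automatically do not cross.) -/
structure IsPennyGraph {V : Type*} (G : SimpleGraph V) (p : V → Plane) : Prop where
  one_le_dist : ∀ u v : V, u ≠ v → 1 ≤ dist (p u) (p v)
  adj_iff : ∀ u v : V, G.Adj u v ↔ dist (p u) (p v) = 1

/-- The points `p v` are in general position: no three of them are collinear. -/
def InGeneralPosition {V : Type*} (p : V → Plane) : Prop :=
  ∀ u v w : V, u ≠ v → u ≠ w → v ≠ w → ¬ Collinear ℝ {p u, p v, p w}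

/-- The four distinct vertices `l, u, r, d`, all of degree `5`, form a kernel: `l u r d` is a
`4`-cycle with the diagonal `l r`. Adjacent vertices are distinct, so only `u ≠ d` has to be
required. -/
structure IsKernel {V : Type*} [Fintype V] (G : SimpleGraph V) [DecidableRel G.Adj]
    (l u r d : V) : Prop where
  degree_l : G.degree l = 5
  degree_u : G.degree u = 5
  degree_r : G.degree r = 5
  degree_d : G.degree d = 5
  u_ne_d : u ≠ d
  adj_lu : G.Adj l u
  adj_ur : G.Adj u r
  adj_rd : G.Adj r d
  adj_dl : G.Adj d l
  adj_lr : G.Adj l r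

/-- The vertex `v` is one of the four vertices of some kernel. -/
def BelongsToKernel {V : Type*} [Fintype V] (G : SimpleGraph V) [DecidableRel G.Adj]
    (v : V) : Prop :=
  ∃ l u r d : V, IsKernel G l u r d ∧ (v = l ∨ v = u ∨ v = r ∨ v = d)

/-- A vertex of degree `5` is popular if at most one of its neighbors has degree `4`, while all
its other neighbors have degree `5`. -/
def IsPopular {V : Type*} [Fintype V] (G : SimpleGraph V) [DecidableRel G.Adj]
    (v : V) : Prop :=
  G.degree v = 5 ∧
    (∀ w : V, G.Adj v w → G.degree w = 4 ∨ G.degree w = 5) ∧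
    ((G.neighborFinset v).filter (fun w => G.degree w = 4)).card ≤ 1

/-!
Identify the plane with `ℂ`, measure angles in units of `π / 3`, and list the neighbors of a vertex
in counterclockwise order. The angles between consecutive neighbors are at least `1` and add up to
`6`; an angle is `1` exactly when the two neighbors are adjacent. General position excludes the
partial sum `3`. Everything follows from three local estimates.

* The two angles at one side of an edge add up to at least `3`, unless the face there is a triangle
  (`IsTurn.edge`). In the case of equality the face is a rhombus.
* Three consecutive angles of a face that is neither a triangle nor a rhombus, the outer two
  exceeding `1`, add up to more than `5` (`IsTurn.pentagon`).
* By the first estimate, an edge between vertices of degree `5` lies in a triangle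
  (`IsFan₅.eq_one_or`), and the surroundings of a kernel are rigid, with a rhombus at each of its
  four sides (`IsOrientedKernel.angles`).

Suppose that every neighbor `b` of the vertex `a` of degree `4` is popular or in a kernel. The last
point leaves few possibilities for which faces at `b` are triangles (`NeighborType`). The proof then
distinguishes which of the four faces at `a` are triangles; no three of them are, by general
position. In every case the estimates add up to a contradiction, with one exception: two opposite
triangles, and a rhombus as one of the other faces. There the vertices around the far vertex of the
rhombus are forced so far that three points on a line appear (`false_of_rhombi`).
-/

open Complex ComplexConjugate

/-! ### Rotations and distances in the plane -/

/-- Rotation by `t` sixths of a full turn. With this unit an equilateral triangle has angles `1`,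
a straight angle is `3` and a full turn is `6`. -/
noncomputable def rot (t : ℝ) : ℂ := Complex.exp ((t * (Real.pi / 3) : ℝ) * I)

theorem rot_re (t : ℝ) : (rot t).re = Real.cos (t * (Real.pi / 3)) := by
  rw [rot, Complex.exp_ofReal_mul_I_re]

theorem rot_im (t : ℝ) : (rot t).im = Real.sin (t * (Real.pi / 3)) := by
  rw [rot, Complex.exp_ofReal_mul_I_im]

theorem rot_add (s t : ℝ) : rot (s + t) = rot s * rot t := by
  simp only [rot, ← Complex.exp_add]
  congr 1
  push_cast
  ring

@[simp] theorem rot_zero : rot 0 = 1 := by simp [rot]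

theorem rot_three : rot 3 = -1 := by
  apply Complex.ext
  · rw [rot_re]
    simp [show (3 : ℝ) * (Real.pi / 3) = Real.pi by ring]
  · rw [rot_im]
    simp [show (3 : ℝ) * (Real.pi / 3) = Real.pi by ring]

theorem rot_six : rot 6 = 1 := by
  rw [show (6 : ℝ) = 3 + 3 by norm_num, rot_add, rot_three]
  norm_num

@[simp] theorem norm_rot (t : ℝ) : ‖rot t‖ = 1 := by
  rw [rot, Complex.norm_exp_ofReal_mul_I]

theorem rot_neg_mul_rot (t : ℝ) : rot (-t) * rot t = 1 := by
  rw [← rot_add]; simp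

theorem conj_rot (t : ℝ) : conj (rot t) = rot (-t) := by
  apply Complex.ext
  · rw [Complex.conj_re, rot_re, rot_re, neg_mul, Real.cos_neg]
  · rw [Complex.conj_im, rot_im, rot_im, neg_mul, Real.sin_neg]

/-- The hexagonal relation `ρ + ρ⁻¹ = 1` for the rotation `ρ` by `π / 3`. -/
theorem rot_one_add_rot_neg_one : rot 1 + rot (-1) = 1 := by
  apply Complex.ext
  · rw [Complex.add_re, rot_re, rot_re, neg_mul, Real.cos_neg, one_mul, Real.cos_pi_div_three]
    norm_num
  · rw [Complex.add_im, rot_im, rot_im, neg_mul, Real.sin_neg]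
    simp

theorem cos_half_of_le {t : ℝ} (h0 : 0 ≤ t) (h1 : t < 1) :
    1 / 2 < Real.cos (t * (Real.pi / 3)) := by
  rw [← Real.cos_pi_div_three]
  have := Real.pi_pos
  apply Real.cos_lt_cos_of_nonneg_of_le_pi <;> nlinarith

/-- Two unit vectors at distance at least `1` form an angle of at least `π / 3`. -/
theorem one_le_of_one_le_norm {s t : ℝ} (h0 : s < t) (h6 : t < s + 6)
    (h : 1 ≤ ‖rot t - rot s‖) : 1 ≤ t - s ∧ t - s ≤ 5 := by
  have key : ‖rot t - rot s‖ ^ 2 = 2 - 2 * Real.cos ((t - s) * (Real.pi / 3)) := by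
    rw [Complex.sq_norm, Complex.normSq_apply, sub_mul, Real.cos_sub]
    simp only [Complex.sub_re, Complex.sub_im, rot_re, rot_im]
    linear_combination Real.sin_sq_add_cos_sq (t * (Real.pi / 3)) +
      Real.sin_sq_add_cos_sq (s * (Real.pi / 3))
  have h1 : 1 ≤ ‖rot t - rot s‖ ^ 2 := by nlinarith
  constructor
  · by_contra! hc
    have := cos_half_of_le (t := t - s) (by linarith) hc
    linarith
  · by_contra! hc
    have := cos_half_of_le (t := 6 - (t - s)) (by linarith) (by linarith)
    rw [show (6 - (t - s)) * (Real.pi / 3) = 2 * Real.pi - (t - s) * (Real.pi / 3) by ring,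
      Real.cos_two_pi_sub] at this
    linarith

theorem rot_injective {s t : ℝ} (h : rot s = rot t) (h1 : s - t < 6) (h2 : t - s < 6) :
    s = t := by
  simp only [rot] at h
  obtain ⟨n, hn⟩ := Complex.exp_eq_exp_iff_exists_int.1 h
  have hn' : s * (Real.pi / 3) = t * (Real.pi / 3) + n * (2 * Real.pi) := by
    have := congrArg Complex.im hn
    simpa using this
  have hp := Real.pi_pos
  have e : s - t = n * 6 := by
    have : (s - t - n * 6) * (Real.pi / 3) = 0 := by linarith
    rcases mul_eq_zero.1 this with h | h
    · linarith
    · linarith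
  have n1 : (n : ℝ) < 1 := by linarith
  have n2 : (-1 : ℝ) < n := by linarith
  have n1' : n < 1 := by exact_mod_cast n1
  have n2' : -1 < n := by exact_mod_cast n2
  have : n = 0 := by omega
  subst this
  simp at e
  linarith

theorem exists_rot_eq {x : ℂ} (hx : ‖x‖ = 1) : ∃ t : ℝ, 0 ≤ t ∧ t < 6 ∧ x = rot t := by
  have hp := Real.pi_pos
  have e : x = rot (x.arg / (Real.pi / 3)) := by
    rw [rot, div_mul_cancel₀ _ (by positivity)]
    conv_lhs => rw [← Complex.norm_mul_exp_arg_mul_I x, hx]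
    simp
  have l : -3 < x.arg / (Real.pi / 3) := by
    rw [lt_div_iff₀ (by positivity)]; linarith [Complex.neg_pi_lt_arg x]
  have u : x.arg / (Real.pi / 3) ≤ 3 := by
    rw [div_le_iff₀ (by positivity)]; linarith [Complex.arg_le_pi x]
  rcases le_or_gt 0 (x.arg / (Real.pi / 3)) with h | h
  · exact ⟨_, h, by linarith, e⟩
  · refine ⟨x.arg / (Real.pi / 3) + 6, by linarith, by linarith, ?_⟩
    rw [rot_add, rot_six, mul_one]; exact e

/-- Unit vectors erected on the two ends of a unit segment, on the same side and with angle sum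
less than `π`, have their tips less than `1` apart. -/
theorem norm_tips_lt_one {s t : ℝ} (hs : 0 < s) (ht : 0 < t) (h : s + t < 3) :
    ‖1 + rot (3 - t) - rot s‖ < 1 := by
  have hp := Real.pi_pos
  set A := s * (Real.pi / 3) with hA
  set C := t * (Real.pi / 3) with hC
  have hB : (3 - t) * (Real.pi / 3) = Real.pi - C := by rw [hC]; ring
  have key : ‖1 + rot (3 - t) - rot s‖ ^ 2 =
      3 - 2 * Real.cos C - 2 * Real.cos A + 2 * Real.cos (A + C) := by
    rw [Complex.sq_norm, Complex.normSq_apply, Real.cos_add]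
    simp only [Complex.sub_re, Complex.sub_im, Complex.add_re, Complex.add_im, rot_re, rot_im,
      Complex.one_re, Complex.one_im, ← hA, hB, Real.cos_pi_sub, Real.sin_pi_sub]
    linear_combination Real.sin_sq_add_cos_sq A + Real.sin_sq_add_cos_sq C
  have e1 : Real.cos A + Real.cos C = 2 * Real.cos ((A + C) / 2) * Real.cos ((A - C) / 2) :=
    Real.cos_add_cos A C
  have e2 : Real.cos (A + C) = 2 * Real.cos ((A + C) / 2) ^ 2 - 1 := by
    rw [← Real.cos_two_mul]; congr 1; ring
  have p1 : 0 < Real.cos ((A + C) / 2) := by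
    apply Real.cos_pos_of_mem_Ioo
    constructor <;> rw [hA, hC] <;> nlinarith
  have p2 : Real.cos ((A + C) / 2) < Real.cos ((A - C) / 2) := by
    rw [← Real.cos_abs ((A - C) / 2)]
    apply Real.cos_lt_cos_of_nonneg_of_le_pi (abs_nonneg _)
    · rw [hA, hC]; nlinarith
    · rw [abs_lt, hA, hC]
      constructor <;> nlinarith
  have : ‖1 + rot (3 - t) - rot s‖ ^ 2 < 1 := by nlinarith
  nlinarith [norm_nonneg (1 + rot (3 - t) - rot s)]

theorem rot_sub_rot (s t : ℝ) :
    rot s - rot t = 2 * I * Real.sin ((s - t) / 2 * (Real.pi / 3)) * rot ((s + t) / 2) := by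
  apply Complex.ext
  · simp only [Complex.sub_re, Complex.mul_re, Complex.mul_im, rot_re, rot_im,
      Complex.I_re, Complex.I_im, Complex.ofReal_re, Complex.ofReal_im, Complex.re_ofNat,
      Complex.im_ofNat, Real.cos_sub_cos]
    ring_nf
  · simp only [Complex.sub_im, Complex.mul_re, Complex.mul_im, rot_re, rot_im,
      Complex.I_re, Complex.I_im, Complex.ofReal_re, Complex.ofReal_im, Complex.re_ofNat,
      Complex.im_ofNat, Real.sin_sub_sin]
    ring_nf

/-- The vector between the ends of a path with four unit edges, whose middle angle is `g` and
whose other two angles exceed those of the rhombus with angle `g` by `a` and `b`. -/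
theorem norm_sq_path (g a b : ℝ) :
    ‖1 + rot (g - a) - rot g - rot b‖ ^ 2 =
      4 * (Real.sin (a / 2 * (Real.pi / 3)) ^ 2 + Real.sin (b / 2 * (Real.pi / 3)) ^ 2 +
        2 * Real.sin (a / 2 * (Real.pi / 3)) * Real.sin (b / 2 * (Real.pi / 3)) *
          Real.cos ((g - (a + b) / 2) * (Real.pi / 3))) := by
  have e : 1 + rot (g - a) - rot g - rot b =
      -(2 * I) * (Real.sin (a / 2 * (Real.pi / 3)) * rot (g - a / 2) +
        Real.sin (b / 2 * (Real.pi / 3)) * rot (b / 2)) := by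
    have h1 := rot_sub_rot g (g - a)
    have h2 := rot_sub_rot b 0
    rw [show (g - (g - a)) / 2 = a / 2 by ring, show (g + (g - a)) / 2 = g - a / 2 by ring] at h1
    rw [rot_zero, sub_zero, add_zero] at h2
    linear_combination -h1 - h2
  have c : Real.cos ((g - (a + b) / 2) * (Real.pi / 3)) =
      Real.cos ((g - a / 2) * (Real.pi / 3) - b / 2 * (Real.pi / 3)) := by congr 1; ring
  rw [e, norm_mul, mul_pow, c, Real.cos_sub]
  have n : ‖-(2 * I)‖ = 2 := by simp
  rw [n, Complex.sq_norm, Complex.normSq_apply]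
  simp only [Complex.add_re, Complex.add_im, Complex.re_ofReal_mul, Complex.im_ofReal_mul,
    rot_re, rot_im]
  linear_combination
    4 * Real.sin (a / 2 * (Real.pi / 3)) ^ 2 *
        Real.sin_sq_add_cos_sq ((g - a / 2) * (Real.pi / 3)) +
      4 * Real.sin (b / 2 * (Real.pi / 3)) ^ 2 *
        Real.sin_sq_add_cos_sq (b / 2 * (Real.pi / 3))

theorem sin_half_nonneg {a : ℝ} (h0 : 0 ≤ a) (h1 : a < 1) :
    0 ≤ Real.sin (a / 2 * (Real.pi / 3)) := by
  have := Real.pi_pos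
  apply Real.sin_nonneg_of_nonneg_of_le_pi <;> nlinarith

/-- If the two outer angles are not large enough, the ends of the path come too close. Opening the
middle angle brings the ends closer, so it suffices to treat the smallest middle angle
`1 + a + b`, where the hexagonal relation reduces the claim to `norm_tips_lt_one`. -/
theorem norm_path_lt_one {g a b : ℝ} (ha : 0 ≤ a) (hb : 0 ≤ b) (ha1 : a < 1) (hb1 : b < 1)
    (hg : 1 + a + b ≤ g) (hg3 : g < 3) : ‖1 + rot (g - a) - rot g - rot b‖ < 1 := by
  have hp := Real.pi_pos
  have e : 1 + rot (1 + a + b - a) - rot (1 + a + b) - rot b =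
      1 + rot (3 - (1 - b)) - rot (1 + a + b) := by
    have h1 := rot_one_add_rot_neg_one
    have h2 : rot (1 + a + b - a) = rot b * rot 1 := by rw [← rot_add]; congr 1; ring
    have h3 : rot (3 - (1 - b)) = rot b * (rot 3 * rot (-1)) := by
      rw [← rot_add, ← rot_add]; congr 1; ring
    rw [rot_three] at h3
    rw [h2, h3]
    linear_combination rot b * h1
  have h0 := norm_tips_lt_one (s := 1 + a + b) (t := 1 - b) (by linarith) (by linarith)
    (by linarith)
  rw [← e] at h0
  have k0 := norm_sq_path (1 + a + b) a b
  have k := norm_sq_path g a b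
  have sa := sin_half_nonneg ha ha1
  have sb := sin_half_nonneg hb hb1
  have cc : Real.cos ((g - (a + b) / 2) * (Real.pi / 3)) ≤
      Real.cos ((1 + a + b - (a + b) / 2) * (Real.pi / 3)) := by
    apply Real.cos_le_cos_of_nonneg_of_le_pi <;> nlinarith
  have := mul_le_mul_of_nonneg_left cc (mul_nonneg sa sb)
  have h2 : ‖1 + rot (g - a) - rot g - rot b‖ ^ 2 < 1 := by
    nlinarith [norm_nonneg (1 + rot (1 + a + b - a) - rot (1 + a + b) - rot b)]
  nlinarith [norm_nonneg (1 + rot (g - a) - rot g - rot b)]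

theorem eq_zero_of_path_closed {g a b : ℝ} (ha : 0 ≤ a) (hb : 0 ≤ b) (ha1 : a < 1) (hb1 : b < 1)
    (hg : 1 + a + b ≤ g) (hg3 : g < 3) (h : 1 + rot (g - a) - rot g - rot b = 0) :
    a = 0 ∧ b = 0 := by
  have hp := Real.pi_pos
  have k := norm_sq_path g a b
  rw [h, norm_zero] at k
  have c : -1 < Real.cos ((g - (a + b) / 2) * (Real.pi / 3)) := by
    rw [← Real.cos_pi]
    apply Real.cos_lt_cos_of_nonneg_of_le_pi <;> nlinarith
  have sa := sin_half_nonneg ha ha1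
  have sb := sin_half_nonneg hb hb1
  set x := Real.sin (a / 2 * (Real.pi / 3)) with hx
  set y := Real.sin (b / 2 * (Real.pi / 3)) with hy
  set z := Real.cos ((g - (a + b) / 2) * (Real.pi / 3))
  have xy : x * y * (1 + z) ≥ 0 := mul_nonneg (mul_nonneg sa sb) (by linarith)
  have e : x = y := by nlinarith [sq_nonneg (x - y)]
  have x0 : x = 0 := by
    by_contra hne
    have : 0 < x := lt_of_le_of_ne sa (Ne.symm hne)
    have := mul_pos (mul_pos this this) (show 0 < 1 + z by linarith)
    rw [← e] at k
    nlinarith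
  have z0 : ∀ r : ℝ, 0 ≤ r → r < 1 → Real.sin (r / 2 * (Real.pi / 3)) = 0 → r = 0 := by
    intro r h0 h1 hr
    by_contra hne
    have : 0 < r := lt_of_le_of_ne h0 (Ne.symm hne)
    have : 0 < Real.sin (r / 2 * (Real.pi / 3)) := by
      apply Real.sin_pos_of_pos_of_lt_pi <;> nlinarith
    linarith
  exact ⟨z0 a ha ha1 x0, z0 b hb hb1 (by rw [← hy, ← e, x0])⟩

/-! ### Drawings and angles -/

/-- A penny graph in general position, drawn in the complex plane with the vertex `v` at `z v`. -/
structure IsPennyDrawing {V : Type*} (G : SimpleGraph V) (z : V → ℂ) : Prop where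
  one_le_norm : ∀ u v : V, u ≠ v → 1 ≤ ‖z u - z v‖
  adj_iff : ∀ u v : V, G.Adj u v ↔ ‖z u - z v‖ = 1
  im_ne_zero : ∀ u v w : V, u ≠ v → u ≠ w → v ≠ w →
    ((z v - z u) * conj (z w - z u)).im ≠ 0

/-- The neighbor `w'` of `v` is obtained from the neighbor `w` by a counterclockwise turn about `v`
of angle `t ≥ 1`, measured in units of `π / 3`. The two edges need not be consecutive. -/
structure IsTurn {V : Type*} (G : SimpleGraph V) (z : V → ℂ) (v w w' : V) (t : ℝ) : Prop where
  adj_left : G.Adj v w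
  adj_right : G.Adj v w'
  one_le : 1 ≤ t
  eq : z w' - z v = (z w - z v) * rot t

section Turns

variable {V : Type*} {G : SimpleGraph V} {z : V → ℂ}

theorem IsPennyDrawing.eq_of_norm_lt (h : IsPennyDrawing G z) {u v : V} (huv : ‖z u - z v‖ < 1) :
    u = v := by
  by_contra hne
  linarith [h.one_le_norm u v hne]

theorem IsPennyDrawing.mirror (h : IsPennyDrawing G z) : IsPennyDrawing G (fun v => conj (z v)) where
  one_le_norm u v huv := by
    rw [← map_sub, Complex.norm_conj]; exact h.one_le_norm u v huv
  adj_iff u v := by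
    rw [← map_sub, Complex.norm_conj]; exact h.adj_iff u v
  im_ne_zero u v w h1 h2 h3 := by
    have := h.im_ne_zero u v w h1 h2 h3
    rw [← map_sub, ← map_sub, ← map_mul, Complex.conj_im]
    exact neg_ne_zero.2 this

theorem IsPennyDrawing.norm_eq (h : IsPennyDrawing G z) {u v : V} (huv : G.Adj u v) :
    ‖z v - z u‖ = 1 := by
  rw [norm_sub_rev]; exact (h.adj_iff u v).1 huv

theorem IsTurn.mirror {v w w' : V} {t : ℝ} (h : IsTurn G z v w w' t) :
    IsTurn G (fun v => conj (z v)) v w' w t where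
  adj_left := h.adj_right
  adj_right := h.adj_left
  one_le := h.one_le
  eq := by
    rw [← map_sub, ← map_sub, h.eq, map_mul, conj_rot, mul_assoc, rot_neg_mul_rot, mul_one]

theorem IsTurn.of_mirror {v w w' : V} {t : ℝ} (h : IsTurn G (fun v => conj (z v)) v w' w t) :
    IsTurn G z v w w' t := by
  have := h.mirror
  simpa using this

theorem IsTurn.eq' {v w w' : V} {t : ℝ} (h : IsTurn G z v w w' t) :
    z w - z v = (z w' - z v) * rot (-t) := by
  have h1 := rot_neg_mul_rot t
  rw [h.eq]
  linear_combination -(z w - z v) * h1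

theorem IsTurn.trans {v u w x : V} {s t : ℝ} (h : IsTurn G z v u w s)
    (h' : IsTurn G z v w x t) : IsTurn G z v u x (s + t) where
  adj_left := h.adj_left
  adj_right := h'.adj_right
  one_le := by linarith [h.one_le, h'.one_le]
  eq := by rw [h'.eq, h.eq, rot_add]; ring

theorem IsPennyDrawing.sub_ne_zero (h : IsPennyDrawing G z) {v w : V} (hvw : G.Adj v w) :
    z w - z v ≠ 0 := by
  have := h.norm_eq hvw
  intro h0
  simp [h0] at this

theorem IsTurn.ne (hz : IsPennyDrawing G z) {v w w' : V} {t : ℝ} (h : IsTurn G z v w w' t)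
    (ht : t < 6) : w ≠ w' := by
  rintro rfl
  have e : rot t = rot 0 := by
    have := h.eq
    rw [rot_zero]
    exact mul_left_cancel₀ (hz.sub_ne_zero h.adj_left) (by rw [← this, mul_one])
  have := rot_injective e (by linarith) (by linarith [h.one_le])
  linarith [h.one_le]

theorem IsTurn.ne_three (hz : IsPennyDrawing G z) {v w w' : V} {t : ℝ}
    (h : IsTurn G z v w w' t) : t ≠ 3 := by
  rintro rfl
  apply hz.im_ne_zero v w w' h.adj_left.ne h.adj_right.ne (h.ne hz (by norm_num))
  rw [h.eq, rot_three, mul_neg_one, map_neg, mul_neg, Complex.mul_conj]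
  simp

/-- Two turns of less than `2` from the same edge lead to the same edge. -/
theorem IsTurn.unique_right (hz : IsPennyDrawing G z) {v w x y : V} {s t : ℝ}
    (h : IsTurn G z v w x s) (h' : IsTurn G z v w y t) (hs : s < 2) (ht : t < 2) :
    x = y ∧ s = t := by
  have hn : ‖z y - z x‖ = ‖rot t - rot s‖ := by
    rw [show z y - z x = (z w - z v) * (rot t - rot s) by
      linear_combination h'.eq - h.eq, norm_mul, hz.norm_eq h.adj_left, one_mul]
  have h1 := h.one_le
  have h2 := h'.one_le
  have hst : s = t := by
    by_contra hne
    have hxy : x ≠ y := by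
      rintro rfl
      rw [sub_self, norm_zero] at hn
      exact hne (rot_injective (sub_eq_zero.1 (norm_eq_zero.1 hn.symm)).symm (by linarith)
        (by linarith))
    have hle := hz.one_le_norm y x hxy.symm
    rw [hn] at hle
    rcases lt_or_gt_of_ne hne with hlt | hlt
    · linarith [(one_le_of_one_le_norm hlt (by linarith) hle).1]
    · rw [norm_sub_rev] at hle
      linarith [(one_le_of_one_le_norm hlt (by linarith) hle).1]
  refine ⟨?_, hst⟩
  subst hst
  rw [sub_self, norm_zero] at hn
  exact (hz.eq_of_norm_lt (by rw [hn]; norm_num)).symm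

theorem IsTurn.unique_left (hz : IsPennyDrawing G z) {v w x y : V} {s t : ℝ}
    (h : IsTurn G z v x w s) (h' : IsTurn G z v y w t) (hs : s < 2) (ht : t < 2) :
    x = y ∧ s = t :=
  h.mirror.unique_right hz.mirror h'.mirror hs ht

/-- A corner of angle `1` spans a triangle. -/
theorem IsTurn.triangle (hz : IsPennyDrawing G z) {v w x : V} (h : IsTurn G z v w x 1) :
    IsTurn G z w x v 1 := by
  have e : z v - z w = (z x - z w) * rot 1 := by
    have h1 : rot 1 * rot 1 = rot 1 - 1 := by
      have h2 := rot_one_add_rot_neg_one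
      have h3 := rot_neg_mul_rot 1
      linear_combination rot 1 * h2 - h3
    linear_combination -rot 1 * h.eq - (z w - z v) * h1
  have hn : ‖z x - z w‖ = 1 := by
    have := hz.norm_eq h.adj_left.symm
    rwa [e, norm_mul, norm_rot, mul_one] at this
  exact ⟨(hz.adj_iff _ _).2 (by rw [norm_sub_rev]; exact hn), h.adj_left.symm, le_refl 1, e⟩

theorem IsTurn.triangle' (hz : IsPennyDrawing G z) {v w x : V} (h : IsTurn G z v w x 1) :
    IsTurn G z x v w 1 :=
  (h.triangle hz).triangle hz

/-- A triangle has one of the two orientations. -/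
theorem IsPennyDrawing.isTurn_or (hz : IsPennyDrawing G z) {u v w : V} (huv : G.Adj u v)
    (huw : G.Adj u w) (hvw : G.Adj v w) : IsTurn G z u v w 1 ∨ IsTurn G z u w v 1 := by
  have h0 := hz.sub_ne_zero huv
  set q := (z w - z u) / (z v - z u) with hq
  have e : z w - z u = (z v - z u) * q := by rw [hq, mul_div_cancel₀ _ h0]
  have n1 : ‖q‖ = 1 := by
    rw [hq, norm_div, hz.norm_eq huv, hz.norm_eq huw, div_one]
  have n2 : ‖q - 1‖ = 1 := by
    have := hz.norm_eq hvw
    rwa [show z w - z v = (z v - z u) * (q - 1) by linear_combination e, norm_mul,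
      hz.norm_eq huv, one_mul] at this
  have s1 : q.re * q.re + q.im * q.im = 1 := by
    rw [← Complex.normSq_apply, ← Complex.sq_norm, n1, one_pow]
  have s2 : (q.re - 1) * (q.re - 1) + q.im * q.im = 1 := by
    have := Complex.normSq_apply (q - 1)
    rw [← Complex.sq_norm, n2, one_pow] at this
    simpa using this.symm
  have hre : q.re = 1 / 2 := by linarith
  have him : (q.im - √3 / 2) * (q.im + √3 / 2) = 0 := by
    have := Real.mul_self_sqrt (show (0 : ℝ) ≤ 3 by norm_num)
    rw [hre] at s1
    linear_combination s1 - this / 4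
  have r1 : (rot 1).re = 1 / 2 := by rw [rot_re, one_mul, Real.cos_pi_div_three]
  have r2 : (rot 1).im = √3 / 2 := by rw [rot_im, one_mul, Real.sin_pi_div_three]
  rcases mul_eq_zero.1 him with h | h
  · left
    refine ⟨huv, huw, le_refl 1, ?_⟩
    rw [e, show q = rot 1 from Complex.ext (by rw [hre, r1]) (by rw [r2]; linarith)]
  · right
    refine ⟨huw, huv, le_refl 1, ?_⟩
    have : q = rot (-1) := by
      rw [← conj_rot]
      exact Complex.ext (by rw [Complex.conj_re, hre, r1])
        (by rw [Complex.conj_im, r2]; linarith)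
    rw [e, this, mul_assoc, rot_neg_mul_rot, mul_one]

/-- The two angles at one side of an edge belong to a triangle, or their sum is at least `π`. -/
theorem IsTurn.edge (hz : IsPennyDrawing G z) {v w x y : V} {s t : ℝ}
    (h : IsTurn G z v w x s) (h' : IsTurn G z w y v t) :
    (s = 1 ∧ t = 1) ∨ 3 ≤ s + t := by
  by_cases hst : 3 ≤ s + t
  · exact Or.inr hst
  left
  push Not at hst
  have h1 := h.one_le
  have h2 := h'.one_le
  have e : z y - z x = (z w - z v) * (1 + rot (3 - t) - rot s) := by
    have h3 : rot (3 - t) = rot 3 * rot (-t) := by rw [← rot_add]; rfl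
    rw [h3, rot_three]
    linear_combination h'.eq' - h.eq
  have hxy : y = x := by
    apply hz.eq_of_norm_lt
    rw [e, norm_mul, hz.norm_eq h.adj_left, one_mul]
    exact norm_tips_lt_one (by linarith) (by linarith) hst
  subst hxy
  have hn : ‖rot s - rot 0‖ = 1 := by
    have := hz.norm_eq h'.adj_left
    rw [show z y - z w = (z w - z v) * (rot s - rot 0) by
      rw [rot_zero]; linear_combination h.eq, norm_mul, hz.norm_eq h.adj_left, one_mul] at this
    exact this
  have hn' : ‖rot t - rot 0‖ = 1 := by
    have := hz.norm_eq h.adj_right.symm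
    rw [show z v - z y = (z y - z w) * (rot t - rot 0) by
      rw [rot_zero]; linear_combination h'.eq, norm_mul, hz.norm_eq h'.adj_left, one_mul] at this
    exact this
  -- If `s > 1`, the isosceles triangle with apex angle `s` has a base longer than `1`.
  have aux : ∀ r : ℝ, 1 ≤ r → r < 2 → ‖rot r - rot 0‖ = 1 → r = 1 := by
    intro r hr hr2 hnr
    have key : ‖rot r - rot 0‖ ^ 2 = 2 - 2 * Real.cos (r * (Real.pi / 3)) := by
      rw [Complex.sq_norm, Complex.normSq_apply, rot_zero]
      simp only [Complex.sub_re, Complex.sub_im, rot_re, rot_im, Complex.one_re, Complex.one_im]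
      linear_combination Real.sin_sq_add_cos_sq (r * (Real.pi / 3))
    rw [hnr] at key
    have hp := Real.pi_pos
    have := Real.injOn_cos (x₁ := r * (Real.pi / 3)) (x₂ := Real.pi / 3)
      ⟨by positivity, by nlinarith⟩ ⟨by positivity, by linarith⟩
      (by rw [Real.cos_pi_div_three]; linarith)
    have h0 : (r - 1) * (Real.pi / 3) = 0 := by linarith
    rcases mul_eq_zero.1 h0 with h | h <;> linarith
  exact ⟨aux s h1 (by linarith) hn, aux t h2 (by linarith) hn'⟩

theorem IsTurn.edge_of_one_lt (hz : IsPennyDrawing G z) {v w x y : V} {s t : ℝ}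
    (h : IsTurn G z v w x s) (h' : IsTurn G z w y v t) (hs : 1 < s) : 3 ≤ s + t := by
  rcases h.edge hz h' with h | h
  · linarith [h.1]
  · exact h

theorem IsTurn.edge_of_one_lt' (hz : IsPennyDrawing G z) {v w x y : V} {s t : ℝ}
    (h : IsTurn G z v w x s) (h' : IsTurn G z w y v t) (ht : 1 < t) : 3 ≤ s + t := by
  rcases h.edge hz h' with h | h
  · linarith [h.2]
  · exact h

/-- If the two angles at one side of an edge add up to `π`, the face there is a rhombus. -/
theorem IsTurn.rhombus {v w x y : V} {s t : ℝ}
    (h : IsTurn G z v w x s) (h' : IsTurn G z w y v t) (hst : s + t = 3) :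
    z y = z w + z x - z v := by
  have h3 : rot s = rot 3 * rot (-t) := by rw [← rot_add]; congr 1; linarith
  rw [rot_three] at h3
  linear_combination h'.eq' - h.eq - (z w - z v) * h3

/-- The angle of the rhombus `v w y x` at `x`. -/
theorem IsTurn.rhombus_right (hz : IsPennyDrawing G z) {v w x y : V} {s t : ℝ}
    (h : IsTurn G z v w x s) (h' : IsTurn G z w y v t) (hst : s + t = 3) :
    IsTurn G z x v y t := by
  have e := h.rhombus h' hst
  have hn := hz.norm_eq h.adj_left
  refine ⟨h.adj_right.symm, (hz.adj_iff _ _).2 ?_, h'.one_le, ?_⟩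
  · rw [norm_sub_rev, show z y - z x = z w - z v by linear_combination e, hn]
  · have h3 : rot s * rot t = -1 := by rw [← rot_add, hst, rot_three]
    linear_combination e + rot t * h.eq + (z w - z v) * h3

/-- The angle of the rhombus `v w y x` at `y`. -/
theorem IsTurn.rhombus_opposite (hz : IsPennyDrawing G z) {v w x y : V} {s t : ℝ}
    (h : IsTurn G z v w x s) (h' : IsTurn G z w y v t) (hst : s + t = 3) :
    IsTurn G z y x w s := by
  have e := h.rhombus h' hst
  refine ⟨(h.rhombus_right hz h' hst).adj_right.symm, h'.adj_left.symm, h.one_le, ?_⟩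
  linear_combination (-1 + rot s) * e - h.eq

/-- A face with consecutive vertices `x, v, u, w, y` and without triangles at `v`, `u`, `w` is
either a rhombus or has large angles at `v`, `u` and `w`: otherwise `x` and `y` would be too
close. -/
theorem IsTurn.pentagon (hz : IsPennyDrawing G z) {u v w x y : V} {g s t : ℝ}
    (hu : IsTurn G z u v w g) (hv : IsTurn G z v x u s) (hw : IsTurn G z w u y t)
    (hs : 1 < s) (ht : 1 < t) :
    5 < g + s + t ∨ (g + s = 3 ∧ g + t = 3 ∧ x = y) := by
  have h1 := hu.edge_of_one_lt' hz hv hs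
  have h2 := hw.edge_of_one_lt hz hu ht
  rcases lt_or_ge 5 (g + s + t) with h5 | h5
  · exact Or.inl h5
  right
  have e : z x - z y = (z v - z u) *
      (1 + rot (g - (g + s - 3)) - rot g - rot (g + t - 3)) := by
    have e1 : rot (g - (g + s - 3)) = rot 3 * rot (-s) := by rw [← rot_add]; congr 1; ring
    have e2 : rot (g + t - 3) = rot g * rot t * rot 3 := by
      rw [← rot_add, ← rot_add, show g + t - 3 = g + t + 3 + -6 by ring, rot_add (g + t + 3)]
      have := rot_neg_mul_rot 6
      rw [rot_six, mul_one] at this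
      rw [this, mul_one]
    rw [e1, e2, rot_three]
    linear_combination -hw.eq + hv.eq' - (1 - rot t) * hu.eq
  have hxy : x = y := by
    apply hz.eq_of_norm_lt
    rw [e, norm_mul, hz.norm_eq hu.adj_left, one_mul]
    apply norm_path_lt_one <;> linarith
  rw [hxy, sub_self] at e
  have := eq_zero_of_path_closed (by linarith) (by linarith) (by linarith) (by linarith)
    (by linarith) (by linarith)
    ((mul_eq_zero.1 e.symm).resolve_left (hz.sub_ne_zero hu.adj_left))
  exact ⟨by linarith [this.1], by linarith [this.2], hxy⟩

end Turns

/-! ### The cyclic order of the neighbors of a vertex -/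

/-- `v` has exactly the four neighbors `b₁, …, b₄` in counterclockwise order, with the angles
`g₁, …, g₄` between consecutive ones. -/
structure IsFan₄ {V : Type*} (G : SimpleGraph V) (z : V → ℂ) (v b₁ b₂ b₃ b₄ : V)
    (g₁ g₂ g₃ g₄ : ℝ) : Prop where
  turn₁ : IsTurn G z v b₁ b₂ g₁
  turn₂ : IsTurn G z v b₂ b₃ g₂
  turn₃ : IsTurn G z v b₃ b₄ g₃
  turn₄ : IsTurn G z v b₄ b₁ g₄
  sum : g₁ + g₂ + g₃ + g₄ = 6
  mem : ∀ w, G.Adj v w → w = b₁ ∨ w = b₂ ∨ w = b₃ ∨ w = b₄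

/-- `v` has exactly the five neighbors `c₀, …, c₄` in counterclockwise order, with the angles
`x₀, …, x₄` between consecutive ones. -/
structure IsFan₅ {V : Type*} (G : SimpleGraph V) (z : V → ℂ) (v c₀ c₁ c₂ c₃ c₄ : V)
    (x₀ x₁ x₂ x₃ x₄ : ℝ) : Prop where
  turn₀ : IsTurn G z v c₀ c₁ x₀
  turn₁ : IsTurn G z v c₁ c₂ x₁
  turn₂ : IsTurn G z v c₂ c₃ x₂
  turn₃ : IsTurn G z v c₃ c₄ x₃
  turn₄ : IsTurn G z v c₄ c₀ x₄
  sum : x₀ + x₁ + x₂ + x₃ + x₄ = 6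
  mem : ∀ w, G.Adj v w → w = c₀ ∨ w = c₁ ∨ w = c₂ ∨ w = c₃ ∨ w = c₄

section Fans

variable {V : Type*} {G : SimpleGraph V} {z : V → ℂ}

/-- The neighbors of a vertex, sorted by their angles `θ` from a given one `w`. -/
theorem IsPennyDrawing.exists_sorted [Fintype V] [DecidableRel G.Adj] (hz : IsPennyDrawing G z)
    {v w : V} (hvw : G.Adj v w) {n : ℕ} (hn : G.degree v = n + 1) :
    ∃ (c : Fin (n + 1) → V) (θ : Fin (n + 1) → ℝ), c 0 = w ∧ θ 0 = 0 ∧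
      (∀ i, G.Adj v (c i) ∧ z (c i) - z v = (z w - z v) * rot (θ i)) ∧
      (∀ i j, i < j → 1 ≤ θ j - θ i ∧ θ j - θ i ≤ 5) ∧
      ∀ u, G.Adj v u → ∃ i, u = c i := by
  classical
  have hw0 := hz.sub_ne_zero hvw
  have ex : ∀ u, G.Adj v u → ∃ t : ℝ, 0 ≤ t ∧ t < 6 ∧ z u - z v = (z w - z v) * rot t := by
    intro u hu
    obtain ⟨t, h0, h6, ht⟩ := exists_rot_eq (x := (z u - z v) / (z w - z v))
      (by rw [norm_div, hz.norm_eq hu, hz.norm_eq hvw, div_one])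
    exact ⟨t, h0, h6, by rw [← ht, mul_div_cancel₀ _ hw0]⟩
  choose! θ hθ0 hθ6 hθ using ex
  have sep : ∀ u u', G.Adj v u → G.Adj v u' → θ u < θ u' → 1 ≤ θ u' - θ u ∧ θ u' - θ u ≤ 5 := by
    intro u u' hu hu' hlt
    have hne : u' ≠ u := by rintro rfl; exact lt_irrefl _ hlt
    have h1 := hz.one_le_norm u' u hne
    rw [show z u' - z u = (z w - z v) * (rot (θ u') - rot (θ u)) by
      linear_combination hθ u' hu' - hθ u hu, norm_mul, hz.norm_eq hvw, one_mul] at h1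
    exact one_le_of_one_le_norm hlt (by linarith [hθ6 u' hu', hθ0 u hu]) h1
  have inj : ∀ u u', G.Adj v u → G.Adj v u' → θ u = θ u' → u = u' := by
    intro u u' hu hu' he
    apply hz.eq_of_norm_lt
    rw [show z u - z u' = 0 by
      linear_combination hθ u hu - hθ u' hu' + (z w - z v) * congrArg rot he]
    simp
  have hw : θ w = 0 := by
    refine rot_injective ?_ (by linarith [hθ6 w hvw]) (by linarith [hθ0 w hvw])
    rw [rot_zero]
    exact mul_left_cancel₀ hw0 (by rw [← hθ w hvw, mul_one])
  have hcard : ((G.neighborFinset v).image θ).card = n + 1 := by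
    rw [Finset.card_image_of_injOn, G.card_neighborFinset_eq_degree, hn]
    intro u hu u' hu' he
    exact inj u u' (by simpa using hu) (by simpa using hu') he
  set o := ((G.neighborFinset v).image θ).orderEmbOfFin hcard with ho
  have hmem : ∀ i, ∃ u, G.Adj v u ∧ θ u = o i := by
    intro i
    have := Finset.orderEmbOfFin_mem _ hcard i
    rw [Finset.mem_image] at this
    obtain ⟨u, hu, hui⟩ := this
    exact ⟨u, by simpa using hu, hui⟩
  choose c hc hco using hmem
  have surj : ∀ u, G.Adj v u → ∃ i, u = c i := by
    intro u hu
    have : θ u ∈ Set.range o := by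
      rw [ho, Finset.range_orderEmbOfFin]
      simp only [Finset.coe_image, Set.mem_image]
      exact ⟨u, by simpa using hu, rfl⟩
    obtain ⟨i, hi⟩ := this
    exact ⟨i, inj _ _ hu (hc i) (by rw [hco, hi])⟩
  have h0 : c 0 = w := by
    obtain ⟨i, hi⟩ := surj w hvw
    have h1 : o 0 ≤ o i := o.monotone (Fin.zero_le i)
    rw [← hco, ← hco, ← hi, hw] at h1
    exact inj _ _ (hc 0) hvw (by rw [hw]; exact le_antisymm h1 (hθ0 _ (hc 0)))
  refine ⟨c, fun i => θ (c i), h0, by simp only [h0, hw], fun i => ⟨hc i, hθ _ (hc i)⟩, ?_, surj⟩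
  intro i j hij
  refine sep _ _ (hc i) (hc j) ?_
  rw [hco, hco]
  exact o.strictMono hij

theorem isTurn_of_angles {v w x y : V} {s t : ℝ}
    (hx : G.Adj v x ∧ z x - z v = (z w - z v) * rot s)
    (hy : G.Adj v y ∧ z y - z v = (z w - z v) * rot t) (h : 1 ≤ t - s) :
    IsTurn G z v x y (t - s) where
  adj_left := hx.1
  adj_right := hy.1
  one_le := h
  eq := by rw [hy.2, hx.2, mul_assoc, ← rot_add]; congr 2; ring

theorem isTurn_of_angles_wrap {v w x y : V} {s t : ℝ}
    (hx : G.Adj v x ∧ z x - z v = (z w - z v) * rot s)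
    (hy : G.Adj v y ∧ z y - z v = (z w - z v) * rot t) (h : s - t ≤ 5) :
    IsTurn G z v x y (6 - (s - t)) where
  adj_left := hx.1
  adj_right := hy.1
  one_le := by linarith
  eq := by
    rw [hy.2, hx.2, mul_assoc, ← rot_add, show s + (6 - (s - t)) = t + 6 by ring, rot_add,
      rot_six, mul_one]

theorem IsPennyDrawing.exists_fan₄ [Fintype V] [DecidableRel G.Adj] (hz : IsPennyDrawing G z)
    {v : V} (hv : G.degree v = 4) :
    ∃ b₁ b₂ b₃ b₄ g₁ g₂ g₃ g₄, IsFan₄ G z v b₁ b₂ b₃ b₄ g₁ g₂ g₃ g₄ := by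
  obtain ⟨w, hw⟩ := (G.degree_pos_iff_exists_adj v).1 (by omega)
  obtain ⟨c, θ, -, -, hc, hθ, hs⟩ := hz.exists_sorted hw (n := 3) hv
  refine ⟨c 0, c 1, c 2, c 3, _, _, _, _,
    isTurn_of_angles (hc 0) (hc 1) (hθ 0 1 (by decide)).1,
    isTurn_of_angles (hc 1) (hc 2) (hθ 1 2 (by decide)).1,
    isTurn_of_angles (hc 2) (hc 3) (hθ 2 3 (by decide)).1,
    isTurn_of_angles_wrap (hc 3) (hc 0) (hθ 0 3 (by decide)).2, by ring, ?_⟩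
  intro u hu
  obtain ⟨i, rfl⟩ := hs u hu
  fin_cases i <;> simp

theorem IsPennyDrawing.exists_fan₅ [Fintype V] [DecidableRel G.Adj] (hz : IsPennyDrawing G z)
    {v w : V} (hv : G.degree v = 5) (hw : G.Adj v w) :
    ∃ c₁ c₂ c₃ c₄ x₀ x₁ x₂ x₃ x₄, IsFan₅ G z v w c₁ c₂ c₃ c₄ x₀ x₁ x₂ x₃ x₄ := by
  obtain ⟨c, θ, hc0, -, hc, hθ, hs⟩ := hz.exists_sorted hw (n := 4) hv
  rw [← hc0]
  refine ⟨c 1, c 2, c 3, c 4, _, _, _, _, _,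
    isTurn_of_angles (hc 0) (hc 1) (hθ 0 1 (by decide)).1,
    isTurn_of_angles (hc 1) (hc 2) (hθ 1 2 (by decide)).1,
    isTurn_of_angles (hc 2) (hc 3) (hθ 2 3 (by decide)).1,
    isTurn_of_angles (hc 3) (hc 4) (hθ 3 4 (by decide)).1,
    isTurn_of_angles_wrap (hc 4) (hc 0) (hθ 0 4 (by decide)).2, by ring, ?_⟩
  intro u hu
  obtain ⟨i, rfl⟩ := hs u hu
  fin_cases i <;> simp

section Four

variable {v b₁ b₂ b₃ b₄ : V} {g₁ g₂ g₃ g₄ : ℝ}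

theorem IsFan₄.rotate (h : IsFan₄ G z v b₁ b₂ b₃ b₄ g₁ g₂ g₃ g₄) :
    IsFan₄ G z v b₂ b₃ b₄ b₁ g₂ g₃ g₄ g₁ where
  turn₁ := h.turn₂
  turn₂ := h.turn₃
  turn₃ := h.turn₄
  turn₄ := h.turn₁
  sum := by linarith [h.sum]
  mem w hw := by have := h.mem w hw; tauto

theorem IsFan₄.mirror (h : IsFan₄ G z v b₁ b₂ b₃ b₄ g₁ g₂ g₃ g₄) :
    IsFan₄ G (fun v => conj (z v)) v b₁ b₄ b₃ b₂ g₄ g₃ g₂ g₁ where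
  turn₁ := h.turn₄.mirror
  turn₂ := h.turn₃.mirror
  turn₃ := h.turn₂.mirror
  turn₄ := h.turn₁.mirror
  sum := by linarith [h.sum]
  mem w hw := by have := h.mem w hw; tauto

/-- Consecutive neighbors in a fan are also the first ones in the sense of turning: there is no
neighbor of `v` strictly between `b₁` and `b₂`. -/
theorem IsFan₄.next_unique (hz : IsPennyDrawing G z) (h : IsFan₄ G z v b₁ b₂ b₃ b₄ g₁ g₂ g₃ g₄)
    {w : V} {t : ℝ} (hw : IsTurn G z v b₁ w t) (ht : t < 2) : w = b₂ ∧ g₁ = t := by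
  have h1 := h.turn₁.one_le
  have h2 := h.turn₂.one_le
  have h3 := h.turn₃.one_le
  have h4 := h.turn₄.one_le
  have hs := h.sum
  have ht1 := hw.one_le
  have key : ∀ s, IsTurn G z v b₁ w s → s < 6 → s = t := by
    intro s hs hs6
    have e : rot s = rot t :=
      mul_left_cancel₀ (hz.sub_ne_zero hw.adj_left) (by rw [← hs.eq, ← hw.eq])
    exact rot_injective e (by linarith) (by linarith [hs.one_le])
  rcases h.mem w hw.adj_right with rfl | rfl | rfl | rfl
  · exact absurd rfl (hw.ne hz (by linarith))
  · exact ⟨rfl, key _ h.turn₁ (by linarith)⟩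
  · linarith [key _ (h.turn₁.trans h.turn₂) (by linarith)]
  · linarith [key _ ((h.turn₁.trans h.turn₂).trans h.turn₃) (by linarith)]

theorem IsFan₄.prev_unique (hz : IsPennyDrawing G z) (h : IsFan₄ G z v b₁ b₂ b₃ b₄ g₁ g₂ g₃ g₄)
    {w : V} {t : ℝ} (hw : IsTurn G z v w b₁ t) (ht : t < 2) : w = b₄ ∧ g₄ = t :=
  h.mirror.next_unique hz.mirror hw.mirror ht

end Four

section Five

variable {v c₀ c₁ c₂ c₃ c₄ : V} {x₀ x₁ x₂ x₃ x₄ : ℝ}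

theorem IsFan₅.rotate (h : IsFan₅ G z v c₀ c₁ c₂ c₃ c₄ x₀ x₁ x₂ x₃ x₄) :
    IsFan₅ G z v c₁ c₂ c₃ c₄ c₀ x₁ x₂ x₃ x₄ x₀ where
  turn₀ := h.turn₁
  turn₁ := h.turn₂
  turn₂ := h.turn₃
  turn₃ := h.turn₄
  turn₄ := h.turn₀
  sum := by linarith [h.sum]
  mem w hw := by have := h.mem w hw; tauto

theorem IsFan₅.mirror (h : IsFan₅ G z v c₀ c₁ c₂ c₃ c₄ x₀ x₁ x₂ x₃ x₄) :
    IsFan₅ G (fun v => conj (z v)) v c₀ c₄ c₃ c₂ c₁ x₄ x₃ x₂ x₁ x₀ where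
  turn₀ := h.turn₄.mirror
  turn₁ := h.turn₃.mirror
  turn₂ := h.turn₂.mirror
  turn₃ := h.turn₁.mirror
  turn₄ := h.turn₀.mirror
  sum := by linarith [h.sum]
  mem w hw := by have := h.mem w hw; tauto

theorem IsFan₅.add_ne (hz : IsPennyDrawing G z) (h : IsFan₅ G z v c₀ c₁ c₂ c₃ c₄ x₀ x₁ x₂ x₃ x₄) :
    x₀ + x₁ ≠ 3 ∧ x₁ + x₂ ≠ 3 ∧ x₂ + x₃ ≠ 3 ∧ x₃ + x₄ ≠ 3 ∧ x₄ + x₀ ≠ 3 :=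
  ⟨(h.turn₀.trans h.turn₁).ne_three hz, (h.turn₁.trans h.turn₂).ne_three hz,
    (h.turn₂.trans h.turn₃).ne_three hz, (h.turn₃.trans h.turn₄).ne_three hz,
    (h.turn₄.trans h.turn₀).ne_three hz⟩

/-- Basic inequalities for the angles at a vertex of degree `5`. The upper bound holds because
an angle of at least `2` would leave only equilateral triangles for the other four faces, and three
of them in a row form a straight angle. -/
theorem IsFan₅.bounds (hz : IsPennyDrawing G z) (h : IsFan₅ G z v c₀ c₁ c₂ c₃ c₄ x₀ x₁ x₂ x₃ x₄) :
    (1 ≤ x₀ ∧ x₀ < 2) ∧ (1 ≤ x₁ ∧ x₁ < 2) ∧ (1 ≤ x₂ ∧ x₂ < 2) ∧ (1 ≤ x₃ ∧ x₃ < 2) ∧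
      (1 ≤ x₄ ∧ x₄ < 2) := by
  have h0 := h.turn₀.one_le
  have h1 := h.turn₁.one_le
  have h2 := h.turn₂.one_le
  have h3 := h.turn₃.one_le
  have h4 := h.turn₄.one_le
  have hs := h.sum
  obtain ⟨a, b, c, d, e⟩ := h.add_ne hz
  refine ⟨⟨h0, ?_⟩, ⟨h1, ?_⟩, ⟨h2, ?_⟩, ⟨h3, ?_⟩, ⟨h4, ?_⟩⟩ <;> by_contra! hc
  · exact a (by linarith)
  · exact b (by linarith)
  · exact c (by linarith)
  · exact d (by linarith)
  · exact e (by linarith)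

/-- Of the two faces at an edge between vertices of degree `5`, at least one is a triangle:
otherwise both faces are rhombi, and at either end the other three angles form a straight angle. -/
theorem IsFan₅.eq_one_or (hz : IsPennyDrawing G z) [Fintype V] [DecidableRel G.Adj]
    (h : IsFan₅ G z v c₀ c₁ c₂ c₃ c₄ x₀ x₁ x₂ x₃ x₄) (hc : G.degree c₀ = 5) :
    x₀ = 1 ∨ x₄ = 1 := by
  obtain ⟨d₁, d₂, d₃, d₄, y₀, y₁, y₂, y₃, y₄, k⟩ := hz.exists_fan₅ hc h.turn₀.adj_left.symm
  by_contra! hne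
  obtain ⟨⟨h0, -⟩, ⟨h1, -⟩, ⟨h2, -⟩, ⟨h3, -⟩, ⟨h4, -⟩⟩ := h.bounds hz
  obtain ⟨-, ⟨k1, -⟩, ⟨k2, -⟩, ⟨k3, -⟩, -⟩ := k.bounds hz
  have e1 := h.turn₀.edge_of_one_lt hz k.turn₄ (lt_of_le_of_ne h0 hne.1.symm)
  have e2 := k.turn₀.edge_of_one_lt' hz h.turn₄ (lt_of_le_of_ne h4 hne.2.symm)
  have := h.sum
  have := k.sum
  exact (h.add_ne hz).2.2.2.2 (by linarith)

end Five

section Faces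

variable {a b₁ b₂ b₃ b₄ c₁ c₂ c₃ c₄ : V} {g₁ g₂ g₃ g₄ x₀ x₁ x₂ x₃ x₄ : ℝ}

/-- The face to the left of the edge from `a` to `b₁`. -/
theorem IsFan₄.left_face (hz : IsPennyDrawing G z) (ha : IsFan₄ G z a b₁ b₂ b₃ b₄ g₁ g₂ g₃ g₄)
    (hb : IsFan₅ G z b₁ a c₁ c₂ c₃ c₄ x₀ x₁ x₂ x₃ x₄) :
    (g₁ = 1 ∧ x₄ = 1 ∧ c₄ = b₂) ∨ (1 < g₁ ∧ 1 < x₄ ∧ 3 ≤ g₁ + x₄) := by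
  obtain ⟨-, -, -, -, h1, h2⟩ := hb.bounds hz
  rcases eq_or_lt_of_le h1 with h | h
  · left
    have t := hb.turn₄
    rw [← h] at t
    obtain ⟨rfl, e⟩ := ha.next_unique hz (t.triangle' hz) (by norm_num)
    exact ⟨e, h.symm, rfl⟩
  · right
    have := ha.turn₁.edge_of_one_lt' hz hb.turn₄ h
    exact ⟨by linarith, h, this⟩

/-- The face to the right of the edge from `a` to `b₁`. -/
theorem IsFan₄.right_face (hz : IsPennyDrawing G z) (ha : IsFan₄ G z a b₁ b₂ b₃ b₄ g₁ g₂ g₃ g₄)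
    (hb : IsFan₅ G z b₁ a c₁ c₂ c₃ c₄ x₀ x₁ x₂ x₃ x₄) :
    (g₄ = 1 ∧ x₀ = 1 ∧ c₁ = b₄) ∨ (1 < g₄ ∧ 1 < x₀ ∧ 3 ≤ g₄ + x₀) :=
  ha.mirror.left_face hz.mirror hb.mirror

end Faces

/-- In the chain of two triangles `a b₁ b₂`, `a b₃ b₄`, the rhombus `a b₄ q b₁`, two more triangles
at `b₄` and a rhombus between them with vertex `e`, the points `b₂`, `b₄` and `e` are collinear. -/
theorem false_of_rhombi (hz : IsPennyDrawing G z) {a b₁ b₂ b₃ b₄ c₂ c₃ q e : V}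
    {g x₀ x₁ x₂ x₃ x₄ : ℝ} (h₁ : IsTurn G z a b₁ b₂ 1) (h₄ : IsTurn G z a b₄ b₁ g)
    (hb : IsFan₅ G z b₄ a b₃ c₂ c₃ q x₀ x₁ x₂ x₃ x₄) (hg : g < 2)
    (hx₀ : x₀ = 1) (hx₁ : x₁ = 1) (hx₃ : x₃ = 1) (hq : z q = z b₄ + z b₁ - z a)
    (he : z e = z c₃ + z c₂ - z b₄) : False := by
  subst hx₀ hx₁ hx₃
  have hpi := Real.pi_pos
  have hg1 := h₄.one_le
  set c : ℝ := 2 * Real.cos ((g - 1) * (Real.pi / 3)) + 1 with hc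
  have hc0 : 0 < c := by
    have := Real.cos_nonneg_of_mem_Icc (x := (g - 1) * (Real.pi / 3)) ⟨by nlinarith, by nlinarith⟩
    linarith
  -- The vectors from `b₂` to `b₄` and from `b₄` to `e` have the same direction.
  have hP : (z e - z b₄) * conj (z b₄ - z b₂) = (c : ℂ) := by
    set v := z b₄ - z a with hv
    have hvv : v * conj v = 1 := by
      rw [Complex.mul_conj, ← Complex.sq_norm, hz.norm_eq h₄.adj_left]; simp
    have r0 := rot_one_add_rot_neg_one
    have r1 := rot_neg_mul_rot 1
    have rg := rot_neg_mul_rot g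
    have hcos : rot g * rot (-1) + rot (-g) * rot 1 = ((c - 1 : ℝ) : ℂ) := by
      rw [← rot_add, ← rot_add, show -g + 1 = -(g + -1) by ring, ← conj_rot, Complex.add_conj,
        rot_re, hc]
      congr 1
      ring_nf
    have e₁ : z b₁ - z a = v * rot g := h₄.eq
    have e₂ : z b₂ - z a = v * rot g * rot 1 := by rw [h₁.eq, e₁]
    have e₃ : z c₂ - z b₄ = -v * rot 1 * rot 1 := by
      rw [hb.turn₁.eq, hb.turn₀.eq, hv]; ring
    have e₄ : z c₃ - z b₄ = v * rot g * rot (-1) := by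
      rw [hb.turn₃.eq', hq, ← e₁]; ring
    have e₅ : z e - z b₄ = v * (rot g * rot (-1) - rot 1 * rot 1) := by
      linear_combination he + e₃ + e₄
    have e₆ : conj (z b₄ - z b₂) = conj v * (1 - rot (-g) * rot (-1)) := by
      rw [show z b₄ - z b₂ = v * (1 - rot g * rot 1) by linear_combination -e₂]
      have : conj (1 - rot g * rot 1) = 1 - rot (-g) * rot (-1) := by
        rw [map_sub, map_one, map_mul, conj_rot, conj_rot]
      rw [map_mul, this]
    push_cast at hcos
    rw [e₅, e₆]
    linear_combination
      (rot g * rot (-1) - rot 1 * rot 1) * (1 - rot (-g) * rot (-1)) * hvv + hcos -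
        rot (-1) * rot (-1) * rg + (rot 1 * rot (-g) + 2) * r1 - (rot 1 + rot (-1) + 1) * r0
  have ne : z e - z b₄ ≠ 0 ∧ conj (z b₄ - z b₂) ≠ 0 := by
    rw [← not_or, ← mul_eq_zero, hP, Complex.ofReal_eq_zero]
    exact hc0.ne'
  refine hz.im_ne_zero b₄ e b₂ ?_ ?_ ?_ ?_
  · rintro rfl; exact ne.1 (sub_self _)
  · rintro rfl; exact ne.2 (by simp)
  · rintro rfl
    have : ((-(Complex.normSq (z b₄ - z e)) : ℝ) : ℂ) = (c : ℂ) := by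
      rw [← hP, Complex.ofReal_neg, ← Complex.mul_conj]; ring
    have := Complex.ofReal_injective this
    linarith [Complex.normSq_nonneg (z b₄ - z e)]
  · rw [show z b₂ - z b₄ = -(z b₄ - z b₂) by ring, map_neg, mul_neg, hP]
    simp

end Fans

/-! ### Kernels and popular vertices -/

section Types

variable {V : Type*} [Fintype V] {G : SimpleGraph V} [DecidableRel G.Adj] {z : V → ℂ}

/-- The possible surroundings of a neighbor `b`, popular or in a kernel, of a vertex `a` of
degree `4`. Here `a, c₁, c₂, c₃, c₄` are the neighbors of `b` in counterclockwise order and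
`x₀, …, x₄` are the angles between them, so that `x₀` and `x₄` belong to the faces to the right and
to the left of the edge from `a` to `b`. The cases differ in which of the angles are those of a
triangle. A turn `IsTurn G z a b e (3 - x₄)` says that the face to the left of the edge is a rhombus
with the vertex `e`. -/
inductive NeighborType (G : SimpleGraph V) [DecidableRel G.Adj] (z : V → ℂ)
    (a b c₁ c₂ c₃ c₄ : V) (x₀ x₁ x₂ x₃ x₄ : ℝ) : Prop
  /-- Neither of the two faces at the edge `a b` is a triangle. -/
  | spread (h₀ : 1 < x₀) (h₁ : x₁ = 1) (h₂ : 1 < x₂) (h₃ : x₃ = 1) (h₄ : 1 < x₄)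
    (d₁ : G.degree c₁ = 5) (d₂ : G.degree c₂ = 5) (d₃ : G.degree c₃ = 5) (d₄ : G.degree c₄ = 5)
  /-- Both faces at the edge `a b` are triangles. -/
  | closed (h₀ : x₀ = 1) (h₁ : 1 < x₁) (h₂ : x₂ = 1) (h₃ : 1 < x₃) (h₄ : x₄ = 1)
  /-- The face to the right is a triangle, and so is the next one. -/
  | left₁ (h₀ : x₀ = 1) (h₁ : x₁ = 1) (h₂ : 1 < x₂) (h₃ : x₃ = 1) (h₄ : 1 < x₄)
    (d₃ : G.degree c₃ = 5) (d₄ : G.degree c₄ = 5)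
    (h : (G.degree c₁ = 5 ∧ G.degree c₂ = 5) ∨ ∃ e, IsTurn G z a b e (3 - x₄))
  /-- The face to the right is a triangle, but the next one is not. -/
  | left₂ (h₀ : x₀ = 1) (h₁ : 1 < x₁) (h₂ : x₂ = 1) (h₃ : x₃ = 1) (h₄ : 1 < x₄)
    (h : ∃ e, IsTurn G z a b e (3 - x₄))
  /-- The mirror image of `left₁`. -/
  | right₁ (h₀ : 1 < x₀) (h₁ : x₁ = 1) (h₂ : 1 < x₂) (h₃ : x₃ = 1) (h₄ : x₄ = 1)
    (d₁ : G.degree c₁ = 5) (d₂ : G.degree c₂ = 5)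
    (h : (G.degree c₃ = 5 ∧ G.degree c₄ = 5) ∨ ∃ e, IsTurn G z a e b (3 - x₀))
  /-- The mirror image of `left₂`. -/
  | right₂ (h₀ : 1 < x₀) (h₁ : x₁ = 1) (h₂ : x₂ = 1) (h₃ : 1 < x₃) (h₄ : x₄ = 1)
    (h : ∃ e, IsTurn G z a e b (3 - x₀))

theorem NeighborType.of_mirror {a b c₁ c₂ c₃ c₄ : V} {x₀ x₁ x₂ x₃ x₄ : ℝ}
    (h : NeighborType G (fun v => conj (z v)) a b c₁ c₂ c₃ c₄ x₀ x₁ x₂ x₃ x₄) :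
    NeighborType G z a b c₄ c₃ c₂ c₁ x₄ x₃ x₂ x₁ x₀ := by
  cases h with
  | spread h₀ h₁ h₂ h₃ h₄ d₁ d₂ d₃ d₄ => exact .spread h₄ h₃ h₂ h₁ h₀ d₄ d₃ d₂ d₁
  | closed h₀ h₁ h₂ h₃ h₄ => exact .closed h₄ h₃ h₂ h₁ h₀
  | left₁ h₀ h₁ h₂ h₃ h₄ d₃ d₄ h =>
    exact .right₁ h₄ h₃ h₂ h₁ h₀ d₄ d₃ (h.imp And.symm fun ⟨e, he⟩ => ⟨e, he.of_mirror⟩)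
  | left₂ h₀ h₁ h₂ h₃ h₄ h =>
    exact .right₂ h₄ h₃ h₂ h₁ h₀ (h.imp fun e he => he.of_mirror)
  | right₁ h₀ h₁ h₂ h₃ h₄ d₁ d₂ h =>
    exact .left₁ h₄ h₃ h₂ h₁ h₀ d₂ d₁ (h.imp And.symm fun ⟨e, he⟩ => ⟨e, he.of_mirror⟩)
  | right₂ h₀ h₁ h₂ h₃ h₄ h =>
    exact .left₂ h₄ h₃ h₂ h₁ h₀ (h.imp fun e he => he.of_mirror)

/-- The neighbors of `b`, listed from `a` on, form one of the patterns of `NeighborType`. -/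
def HasNeighborType (G : SimpleGraph V) [DecidableRel G.Adj] (z : V → ℂ) (a b : V) : Prop :=
  ∃ c₁ c₂ c₃ c₄ x₀ x₁ x₂ x₃ x₄, IsFan₅ G z b a c₁ c₂ c₃ c₄ x₀ x₁ x₂ x₃ x₄ ∧
    NeighborType G z a b c₁ c₂ c₃ c₄ x₀ x₁ x₂ x₃ x₄

theorem HasNeighborType.of_mirror {a b : V}
    (h : HasNeighborType G (fun v => conj (z v)) a b) : HasNeighborType G z a b := by
  obtain ⟨c₁, c₂, c₃, c₄, x₀, x₁, x₂, x₃, x₄, hf, ht⟩ := h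
  refine ⟨c₄, c₃, c₂, c₁, x₄, x₃, x₂, x₁, x₀, ?_, ht.of_mirror⟩
  simpa using hf.mirror

/-- A kernel whose vertices `l, d, r, u` are in counterclockwise order. -/
structure IsOrientedKernel (G : SimpleGraph V) [DecidableRel G.Adj] (z : V → ℂ) (l u r d : V) :
    Prop where
  degree_l : G.degree l = 5
  degree_u : G.degree u = 5
  degree_r : G.degree r = 5
  degree_d : G.degree d = 5
  turn_u : IsTurn G z l r u 1
  turn_d : IsTurn G z l d r 1

section Kernel

variable {l u r d : V}

theorem IsOrientedKernel.rotate (hz : IsPennyDrawing G z) (h : IsOrientedKernel G z l u r d) :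
    IsOrientedKernel G z r d l u :=
  ⟨h.degree_r, h.degree_d, h.degree_l, h.degree_u, h.turn_d.triangle' hz, h.turn_u.triangle hz⟩

theorem IsOrientedKernel.mirror (h : IsOrientedKernel G z l u r d) :
    IsOrientedKernel G (fun v => conj (z v)) l d r u :=
  ⟨h.degree_l, h.degree_d, h.degree_r, h.degree_u, h.turn_d.mirror, h.turn_u.mirror⟩

/-- The surroundings of a kernel are rigid. Going around it, each of its four sides needs an angle
sum of at least `π` outside the kernel; the angles available at its vertices just suffice. Hence
there is a rhombus at each side, and all other angles at the kernel are those of triangles. -/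
theorem IsOrientedKernel.angles (hz : IsPennyDrawing G z) (h : IsOrientedKernel G z l u r d)
    {l₁ l₂ l₃ l₄ u₁ u₂ u₃ u₄ : V} {x₀ x₁ x₂ x₃ x₄ y₀ y₁ y₂ y₃ y₄ : ℝ}
    (hl : IsFan₅ G z l r l₁ l₂ l₃ l₄ x₀ x₁ x₂ x₃ x₄)
    (hu : IsFan₅ G z u l u₁ u₂ u₃ u₄ y₀ y₁ y₂ y₃ y₄) :
    (l₁ = u ∧ l₄ = d ∧ x₀ = 1 ∧ 1 < x₁ ∧ x₂ = 1 ∧ 1 < x₃ ∧ x₄ = 1) ∧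
      (u₁ = r ∧ y₀ = 1 ∧ 1 < y₁ ∧ y₂ = 1 ∧ y₃ = 1 ∧ 1 < y₄) ∧ x₁ + y₄ = 3 := by
  obtain ⟨⟨hx₀, hx₀'⟩, ⟨hx₁, hx₁'⟩, ⟨hx₂, hx₂'⟩, ⟨hx₃, hx₃'⟩, ⟨hx₄, hx₄'⟩⟩ := hl.bounds hz
  obtain ⟨⟨hy₀, hy₀'⟩, ⟨hy₁, hy₁'⟩, ⟨hy₂, hy₂'⟩, ⟨hy₃, hy₃'⟩, ⟨hy₄, hy₄'⟩⟩ := hu.bounds hz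
  have k := h.rotate hz
  obtain ⟨r₁, r₂, r₃, r₄, v₀, v₁, v₂, v₃, v₄, hr⟩ := hz.exists_fan₅ h.degree_r k.turn_u.adj_left
  obtain ⟨d₁, d₂, d₃, d₄, w₀, w₁, w₂, w₃, w₄, hd⟩ :=
    hz.exists_fan₅ h.degree_d (h.turn_d.triangle hz).adj_left
  obtain ⟨⟨hv₀, hv₀'⟩, ⟨hv₁, hv₁'⟩, ⟨hv₂, hv₂'⟩, ⟨hv₃, hv₃'⟩, ⟨hv₄, hv₄'⟩⟩ := hr.bounds hz
  obtain ⟨⟨hw₀, hw₀'⟩, ⟨hw₁, hw₁'⟩, ⟨hw₂, hw₂'⟩, ⟨hw₃, hw₃'⟩, ⟨hw₄, hw₄'⟩⟩ := hd.bounds hz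
  obtain ⟨rfl, rfl⟩ := hl.turn₀.unique_right hz h.turn_u hx₀' (by norm_num)
  obtain ⟨rfl, rfl⟩ := hl.turn₄.unique_left hz h.turn_d hx₄' (by norm_num)
  obtain ⟨rfl, rfl⟩ := hr.turn₀.unique_right hz k.turn_u hv₀' (by norm_num)
  obtain ⟨rfl, rfl⟩ := hr.turn₄.unique_left hz k.turn_d hv₄' (by norm_num)
  obtain ⟨rfl, rfl⟩ := hu.turn₀.unique_right hz (h.turn_u.triangle' hz) hy₀' (by norm_num)
  obtain ⟨rfl, rfl⟩ := hd.turn₀.unique_right hz (h.turn_d.triangle hz) hw₀' (by norm_num)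
  have sl := hl.sum
  have su := hu.sum
  have sr := hr.sum
  have sd := hd.sum
  obtain ⟨-, nl₁, nl₂, -, -⟩ := hl.add_ne hz
  obtain ⟨-, nr₁, nr₂, -, -⟩ := hr.add_ne hz
  have px₁ : 1 < x₁ := lt_of_le_of_ne hx₁ fun e => nl₂ (by linarith)
  have px₃ : 1 < x₃ := lt_of_le_of_ne hx₃ fun e => nl₁ (by linarith)
  have pv₁ : 1 < v₁ := lt_of_le_of_ne hv₁ fun e => nr₂ (by linarith)
  have pv₃ : 1 < v₃ := lt_of_le_of_ne hv₃ fun e => nr₁ (by linarith)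
  have e₁ := hl.turn₁.edge_of_one_lt hz hu.turn₄ px₁
  have e₂ := hu.turn₁.edge_of_one_lt' hz hr.turn₃ pv₃
  have e₃ := hr.turn₁.edge_of_one_lt hz hd.turn₄ pv₁
  have e₄ := hd.turn₁.edge_of_one_lt' hz hl.turn₃ px₃
  refine ⟨⟨rfl, rfl, rfl, px₁, ?_, px₃, rfl⟩, ⟨rfl, rfl, ?_, ?_, ?_, ?_⟩, ?_⟩ <;> linarith

/-- The neighbor `a` of `l` is the one that follows `u` around the vertex `l` of the kernel. -/
theorem IsOrientedKernel.hasNeighborType_l (hz : IsPennyDrawing G z)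
    (h : IsOrientedKernel G z l u r d) {a l₁ l₃ l₄ : V} {x₀ x₁ x₂ x₃ x₄ : ℝ}
    (hl : IsFan₅ G z l r l₁ a l₃ l₄ x₀ x₁ x₂ x₃ x₄) : HasNeighborType G z a l := by
  obtain ⟨u₁, u₂, u₃, u₄, y₀, y₁, y₂, y₃, y₄, hu⟩ :=
    hz.exists_fan₅ h.degree_u (h.turn_u.triangle' hz).adj_left
  obtain ⟨⟨rfl, rfl, hx₀, hx₁, hx₂, hx₃, hx₄⟩, -, hs⟩ := h.angles hz hl hu
  refine ⟨_, _, _, _, _, _, _, _, _, hl.rotate.rotate, .left₂ hx₂ hx₃ hx₄ hx₀ hx₁ ⟨u₄, ?_⟩⟩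
  rw [show 3 - x₁ = y₄ by linarith]
  exact hl.turn₁.rhombus_right hz hu.turn₄ hs

/-- The neighbor `a` of `u` is the one that precedes `l` around the vertex `u` of the kernel. -/
theorem IsOrientedKernel.hasNeighborType_u (hz : IsPennyDrawing G z)
    (h : IsOrientedKernel G z l u r d) {a u₁ u₂ u₃ : V} {y₀ y₁ y₂ y₃ y₄ : ℝ}
    (hu : IsFan₅ G z u l u₁ u₂ u₃ a y₀ y₁ y₂ y₃ y₄) : HasNeighborType G z a u := by
  obtain ⟨l₁, l₂, l₃, l₄, x₀, x₁, x₂, x₃, x₄, hl⟩ := hz.exists_fan₅ h.degree_l h.turn_u.adj_left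
  obtain ⟨⟨rfl, rfl, hx₀, hx₁, hx₂, hx₃, hx₄⟩, ⟨rfl, hy₀, hy₁, hy₂, hy₃, hy₄⟩, hs⟩ :=
    h.angles hz hl hu
  refine ⟨_, _, _, _, _, _, _, _, _, hu.rotate.rotate.rotate.rotate,
    .right₁ hy₄ hy₀ hy₁ hy₂ hy₃ h.degree_l h.degree_r (.inr ⟨l₂, ?_⟩)⟩
  rw [show 3 - y₄ = x₁ by linarith]
  exact hl.turn₁.rhombus_opposite hz hu.turn₄ hs

theorem IsOrientedKernel.hasNeighborType (hz : IsPennyDrawing G z)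
    (h : IsOrientedKernel G z l u r d) {a : V} (ha : G.degree a = 4) :
    (G.Adj a l → HasNeighborType G z a l) ∧ (G.Adj a u → HasNeighborType G z a u) := by
  obtain ⟨l₁, l₂, l₃, l₄, x₀, x₁, x₂, x₃, x₄, hl⟩ := hz.exists_fan₅ h.degree_l h.turn_u.adj_left
  obtain ⟨u₁, u₂, u₃, u₄, y₀, y₁, y₂, y₃, y₄, hu⟩ :=
    hz.exists_fan₅ h.degree_u (h.turn_u.triangle' hz).adj_left
  obtain ⟨⟨rfl, rfl, hx₀, hx₁, hx₂, hx₃, hx₄⟩, ⟨rfl, hy₀, hy₁, hy₂, hy₃, hy₄⟩, hs⟩ :=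
    h.angles hz hl hu
  have ne5 : ∀ v, G.degree v = 5 → a ≠ v := by
    rintro v hv rfl
    omega
  constructor
  · intro hal
    rcases hl.mem a hal.symm with e | e | e | e | e
    · exact absurd e (ne5 _ h.degree_r)
    · exact absurd e (ne5 _ h.degree_u)
    · subst e; exact h.hasNeighborType_l hz hl
    · subst e
      exact (h.mirror.hasNeighborType_l hz.mirror hl.mirror).of_mirror
    · exact absurd e (ne5 _ h.degree_d)
  · intro hau
    rcases hu.mem a hau.symm with e | e | e | e | e
    · exact absurd e (ne5 _ h.degree_l)
    · exact absurd e (ne5 _ h.degree_r)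
    · subst e
      exact ((h.rotate hz).mirror.hasNeighborType_u hz.mirror hu.rotate.mirror).of_mirror
    · subst e
      exact ⟨_, _, _, _, _, _, _, _, _, hu.rotate.rotate.rotate, .closed hy₃ hy₄ hy₀ hy₁ hy₂⟩
    · subst e; exact h.hasNeighborType_u hz hu

end Kernel

theorem IsKernel.oriented (hz : IsPennyDrawing G z) {l u r d : V} (h : IsKernel G l u r d) :
    IsOrientedKernel G z l u r d ∨ IsOrientedKernel G z l d r u := by
  rcases hz.isTurn_or h.adj_lr h.adj_lu h.adj_ur.symm with hu | hu <;>
    rcases hz.isTurn_or h.adj_lr h.adj_dl.symm h.adj_rd with hd | hd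
  · exact absurd (hu.unique_right hz hd (by norm_num) (by norm_num)).1 h.u_ne_d
  · exact .inl ⟨h.degree_l, h.degree_u, h.degree_r, h.degree_d, hu, hd⟩
  · exact .inr ⟨h.degree_l, h.degree_d, h.degree_r, h.degree_u, hd, hu⟩
  · exact absurd (hu.unique_left hz hd (by norm_num) (by norm_num)).1 h.u_ne_d

theorem hasNeighborType_of_kernel (hz : IsPennyDrawing G z) {a b : V} (ha : G.degree a = 4)
    (hab : G.Adj a b) (hb : BelongsToKernel G b) : HasNeighborType G z a b := by
  obtain ⟨l, u, r, d, hk, hb⟩ := hb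
  rcases hk.oriented hz with h | h <;> rcases hb with rfl | rfl | rfl | rfl
  · exact (h.hasNeighborType hz ha).1 hab
  · exact (h.hasNeighborType hz ha).2 hab
  · exact ((h.rotate hz).hasNeighborType hz ha).1 hab
  · exact ((h.rotate hz).hasNeighborType hz ha).2 hab
  · exact (h.hasNeighborType hz ha).1 hab
  · exact ((h.rotate hz).hasNeighborType hz ha).2 hab
  · exact ((h.rotate hz).hasNeighborType hz ha).1 hab
  · exact (h.hasNeighborType hz ha).2 hab

/-- Two adjacent triangles spanned by vertices of degree `5` form a kernel. -/
theorem belongsToKernel_of_turns (hz : IsPennyDrawing G z) {b c₁ c₂ c₃ : V}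
    (h₁ : IsTurn G z b c₁ c₂ 1) (h₂ : IsTurn G z b c₂ c₃ 1) (hb : G.degree b = 5)
    (d₁ : G.degree c₁ = 5) (d₂ : G.degree c₂ = 5) (d₃ : G.degree c₃ = 5) :
    BelongsToKernel G b :=
  ⟨b, c₃, c₂, c₁, ⟨hb, d₃, d₂, d₁, ((h₁.trans h₂).ne hz (by norm_num)).symm, h₂.adj_right,
    (h₂.triangle hz).adj_left.symm, (h₁.triangle hz).adj_left.symm, h₁.adj_left.symm,
    h₁.adj_right⟩, .inl rfl⟩

theorem hasNeighborType_of_isPopular (hz : IsPennyDrawing G z) {a b : V} (ha : G.degree a = 4)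
    (hab : G.Adj a b) (hb : IsPopular G b) : HasNeighborType G z a b := by
  by_cases hk : BelongsToKernel G b
  · exact hasNeighborType_of_kernel hz ha hab hk
  obtain ⟨hb5, hdeg, hcard⟩ := hb
  obtain ⟨c₁, c₂, c₃, c₄, x₀, x₁, x₂, x₃, x₄, h⟩ := hz.exists_fan₅ hb5 hab.symm
  obtain ⟨⟨h0, h0'⟩, ⟨h1, h1'⟩, ⟨h2, h2'⟩, ⟨h3, h3'⟩, ⟨h4, h4'⟩⟩ := h.bounds hz
  have deg : ∀ c, G.Adj b c → a ≠ c → G.degree c = 5 := by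
    intro c hc hne
    refine (hdeg c hc).resolve_left fun h4 => hne ?_
    exact Finset.card_le_one.1 hcard a (by simp [hab.symm, ha]) c (by simp [hc, h4])
  have d₁ := deg c₁ h.turn₁.adj_left (h.turn₀.ne hz (by linarith))
  have d₂ := deg c₂ h.turn₂.adj_left ((h.turn₀.trans h.turn₁).ne hz (by linarith))
  have d₃ := deg c₃ h.turn₃.adj_left ((h.turn₃.trans h.turn₄).ne hz (by linarith)).symm
  have d₄ := deg c₄ h.turn₄.adj_left (h.turn₄.ne hz (by linarith)).symm
  have e₁ := h.rotate.eq_one_or hz d₁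
  have e₂ := h.rotate.rotate.eq_one_or hz d₂
  have e₃ := h.rotate.rotate.rotate.eq_one_or hz d₃
  have e₄ := h.rotate.rotate.rotate.rotate.eq_one_or hz d₄
  have k₁ : ¬(x₁ = 1 ∧ x₂ = 1) := by
    rintro ⟨rfl, rfl⟩
    exact hk (belongsToKernel_of_turns hz h.turn₁ h.turn₂ hb5 d₁ d₂ d₃)
  have k₂ : ¬(x₂ = 1 ∧ x₃ = 1) := by
    rintro ⟨rfl, rfl⟩
    exact hk (belongsToKernel_of_turns hz h.turn₂ h.turn₃ hb5 d₂ d₃ d₄)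
  have hs := h.sum
  refine ⟨c₁, c₂, c₃, c₄, x₀, x₁, x₂, x₃, x₄, h, ?_⟩
  have lt : ∀ {x : ℝ}, 1 ≤ x → x ≠ 1 → 1 < x := fun h h' => lt_of_le_of_ne h h'.symm
  by_cases hx₂ : x₂ = 1
  · have hx₁ : x₁ ≠ 1 := fun h => k₁ ⟨h, hx₂⟩
    have hx₃ : x₃ ≠ 1 := fun h => k₂ ⟨hx₂, h⟩
    exact .closed (e₁.resolve_left hx₁) (lt h1 hx₁) hx₂ (lt h3 hx₃) (e₄.resolve_right hx₃)
  · have hx₁ := e₂.resolve_left hx₂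
    have hx₃ := e₃.resolve_right hx₂
    by_cases hx₀ : x₀ = 1
    · have hx₄ : x₄ ≠ 1 := fun e => (h.add_ne hz).2.1 (by linarith)
      exact .left₁ hx₀ hx₁ (lt h2 hx₂) hx₃ (lt h4 hx₄) d₃ d₄ (.inl ⟨d₁, d₂⟩)
    · by_cases hx₄ : x₄ = 1
      · exact .right₁ (lt h0 hx₀) hx₁ (lt h2 hx₂) hx₃ hx₄ d₁ d₂ (.inl ⟨d₃, d₄⟩)
      · exact .spread (lt h0 hx₀) hx₁ (lt h2 hx₂) hx₃ (lt h4 hx₄) d₁ d₂ d₃ d₄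

end Types

/-! ### The faces around a vertex of degree four -/

section Main

variable {V : Type*} [Fintype V] {G : SimpleGraph V} [DecidableRel G.Adj] {z : V → ℂ}

/-- Let `b c₃ q` be a triangle, with `c₃` of degree `5`. If the angles `x₂` at `b` and `y₂` at `q`
that adjoin the triangle at its sides `b c₃` and `q c₃` are not those of triangles, then the room
left at `c₃` bounds them from below. In the case of equality, the face at `b c₃` is a rhombus. -/
theorem IsFan₅.three_le_add (hz : IsPennyDrawing G z) {a b c₁ c₂ c₃ q b' k d : V}
    {x₀ x₁ x₂ x₃ x₄ y₀ y₁ y₂ y₃ y₄ : ℝ} (hb : IsFan₅ G z b a c₁ c₂ c₃ q x₀ x₁ x₂ x₃ x₄)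
    (hq : IsFan₅ G z q b' b c₃ k d y₀ y₁ y₂ y₃ y₄) (hc : G.degree c₃ = 5)
    (hx₃ : x₃ = 1) (hx₂ : 1 < x₂) (hy₂ : 1 < y₂) :
    3 ≤ y₂ + x₂ ∧ (y₂ + x₂ = 3 → ∃ e, z e = z c₃ + z c₂ - z b) := by
  subst hx₃
  have ht := hb.turn₃.triangle hz
  obtain ⟨n₁, n₂, n₃, n₄, t₀, t₁, t₂, t₃, t₄, hn⟩ := hz.exists_fan₅ hc ht.adj_left
  obtain ⟨⟨-, h0⟩, ⟨h1, -⟩, ⟨h2, -⟩, ⟨h3, -⟩, ⟨h4, -⟩⟩ := hn.bounds hz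
  obtain ⟨rfl, rfl⟩ := hn.turn₀.unique_right hz ht h0 (by norm_num)
  have e₁ := hn.turn₁.edge_of_one_lt' hz hb.turn₂ hx₂
  have e₂ := hq.turn₂.edge_of_one_lt hz hn.turn₄ hy₂
  have hs := hn.sum
  refine ⟨by linarith, fun he => ⟨n₂, ?_⟩⟩
  have := hn.turn₁.rhombus hb.turn₂ (by linarith)
  linear_combination -this

/-- The far vertex `q` of a rhombus `a b q b'` whose sides at `q` adjoin triangles `b c₃ q` and
`b' q d₂`. Besides these, there are two angles `s` and `s'` at `q`. -/
theorem exists_angles_opposite (hz : IsPennyDrawing G z) {a b b' c₁ c₂ c₃ q d₂ d₃ d₄ : V}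
    {g x₀ x₁ x₂ x₃ x₄ y₀ y₁ y₂ y₃ y₄ : ℝ}
    (hb : IsFan₅ G z b a c₁ c₂ c₃ q x₀ x₁ x₂ x₃ x₄)
    (hb' : IsFan₅ G z b' a q d₂ d₃ d₄ y₀ y₁ y₂ y₃ y₄) (ha : IsTurn G z a b b' g)
    (hg : g + x₄ = 3) (hx₃ : x₃ = 1) (hx₂ : 1 < x₂) (hy₁ : y₁ = 1) (hy₂ : 1 < y₂)
    (hx₄ : 1 < x₄) (hq : G.degree q = 5) (hc₃ : G.degree c₃ = 5) (hd₂ : G.degree d₂ = 5) :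
    ∃ s s' : ℝ, 1 ≤ s ∧ 1 ≤ s' ∧ g + s + s' = 4 ∧
      (1 < s → 3 ≤ s + x₂ ∧ (s + x₂ = 3 → ∃ e, z e = z c₃ + z c₂ - z b)) ∧
      (1 < s' → 3 ≤ s' + y₂ ∧ (s' + y₂ = 3 → ∃ e, z e = z d₂ + z d₃ - z b')) := by
  subst hx₃ hy₁
  have t₀ := ha.rhombus_opposite hz hb.turn₄ hg
  have t₁ := hb.turn₃.triangle' hz
  have t₄ := hb'.turn₁.triangle hz
  obtain ⟨n₁, n₂, k, n₄, s₀, s₁, s₂, s₃, s₄, hn⟩ := hz.exists_fan₅ hq t₀.adj_left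
  obtain ⟨⟨-, h0⟩, ⟨-, h1⟩, ⟨h2, -⟩, ⟨h3, -⟩, ⟨-, h4⟩⟩ := hn.bounds hz
  obtain ⟨rfl, rfl⟩ := hn.turn₀.unique_right hz t₀ h0 (by linarith)
  obtain ⟨rfl, rfl⟩ := hn.turn₁.unique_right hz t₁ h1 (by norm_num)
  obtain ⟨rfl, rfl⟩ := hn.turn₄.unique_left hz t₄ h4 (by norm_num)
  refine ⟨s₂, s₃, h2, h3, by linarith [hn.sum], hb.three_le_add hz hn hc₃ rfl hx₂, fun hs => ?_⟩
  obtain ⟨p, p'⟩ := hb'.mirror.three_le_add hz.mirror hn.rotate.mirror hd₂ rfl hy₂ hs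
  refine ⟨p, fun he => ?_⟩
  obtain ⟨e, hze⟩ := p' he
  refine ⟨e, ?_⟩
  have := congrArg conj hze
  simpa using this

/-- Let `m` be the tip of a triangle on the edge `b₁ b₂` of the triangle `a b₁ b₂`. If the triangle
at `m` is the only one with a side `b₁ m` or `b₂ m`, the room left at `m` bounds the angles
`x₄` and `y₀` at `b₂` and `b₁` next to the triangle `a b₁ b₂`. -/
theorem add_le_three_of_tip (hz : IsPennyDrawing G z) {a b₁ b₂ m c₃ c₄ d₁ d₂ : V}
    {x₀ x₁ x₂ x₃ x₄ y₀ y₁ y₂ y₃ y₄ : ℝ}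
    (hb₂ : IsFan₅ G z b₂ a b₁ m c₃ c₄ x₀ x₁ x₂ x₃ x₄)
    (hb₁ : IsFan₅ G z b₁ a d₁ d₂ m b₂ y₀ y₁ y₂ y₃ y₄) (hm : G.degree m = 5)
    (hx₀ : x₀ = 1) (hx₁ : x₁ = 1) (hx₂ : 1 < x₂) (hx₃ : x₃ = 1)
    (hy₁ : y₁ = 1) (hy₂ : 1 < y₂) (hy₃ : y₃ = 1) (hy₄ : y₄ = 1) : x₄ + y₀ ≤ 3 := by
  subst hx₁
  have t := hb₂.turn₁.triangle' hz
  obtain ⟨n₁, p, k, p', s₀, s₁, s₂, s₃, s₄, hn⟩ := hz.exists_fan₅ hm t.adj_left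
  obtain ⟨⟨-, h0⟩, ⟨-, -⟩, ⟨h2, -⟩, ⟨h3, -⟩, ⟨-, -⟩⟩ := hn.bounds hz
  obtain ⟨rfl, rfl⟩ := hn.turn₀.unique_right hz t h0 (by norm_num)
  have e₁ := hb₂.turn₂.edge_of_one_lt hz hn.turn₄ hx₂
  have e₂ := hn.turn₁.edge_of_one_lt' hz hb₁.turn₂ hy₂
  linarith [hn.sum, hb₁.sum, hb₂.sum]

section Faces

variable {a b₁ b₂ b₃ b₄ c₁ c₂ c₃ c₄ : V} {g₁ g₂ g₃ g₄ x₀ x₁ x₂ x₃ x₄ : ℝ}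

theorem NeighborType.of_one_lt (h : NeighborType G z a b₁ c₁ c₂ c₃ c₄ x₀ x₁ x₂ x₃ x₄)
    (h₀ : 1 < x₀) (h₄ : 1 < x₄) : x₁ = 1 ∧ 1 < x₂ ∧ x₃ = 1 ∧ G.degree c₁ = 5 ∧
      G.degree c₂ = 5 ∧ G.degree c₃ = 5 ∧ G.degree c₄ = 5 := by
  cases h with
  | spread _ h₁ h₂ h₃ _ d₁ d₂ d₃ d₄ => exact ⟨h₁, h₂, h₃, d₁, d₂, d₃, d₄⟩
  | closed | left₁ | left₂ | right₁ | right₂ => linarith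

theorem NeighborType.of_eq_one (h : NeighborType G z a b₁ c₁ c₂ c₃ c₄ x₀ x₁ x₂ x₃ x₄)
    (h₀ : x₀ = 1) (h₄ : x₄ = 1) : 1 < x₁ ∧ 1 < x₃ := by
  cases h with
  | closed _ h₁ _ h₃ => exact ⟨h₁, h₃⟩
  | spread | left₁ | left₂ | right₁ | right₂ => linarith

theorem NeighborType.of_left (h : NeighborType G z a b₁ c₁ c₂ c₃ c₄ x₀ x₁ x₂ x₃ x₄)
    (h₀ : x₀ = 1) (h₄ : 1 < x₄) :
    (x₁ = 1 ∧ 1 < x₂ ∧ x₃ = 1 ∧ G.degree c₃ = 5 ∧ G.degree c₄ = 5 ∧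
      ((G.degree c₁ = 5 ∧ G.degree c₂ = 5) ∨ ∃ e, IsTurn G z a b₁ e (3 - x₄))) ∨
    (1 < x₁ ∧ ∃ e, IsTurn G z a b₁ e (3 - x₄)) := by
  cases h with
  | left₁ _ h₁ h₂ h₃ _ d₃ d₄ h => exact .inl ⟨h₁, h₂, h₃, d₃, d₄, h⟩
  | left₂ _ h₁ _ _ _ h => exact .inr ⟨h₁, h⟩
  | spread | closed | right₁ | right₂ => linarith

theorem NeighborType.of_right (h : NeighborType G z a b₁ c₁ c₂ c₃ c₄ x₀ x₁ x₂ x₃ x₄)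
    (h₀ : 1 < x₀) (h₄ : x₄ = 1) :
    (x₁ = 1 ∧ 1 < x₂ ∧ x₃ = 1 ∧ G.degree c₁ = 5 ∧ G.degree c₂ = 5 ∧
      ((G.degree c₃ = 5 ∧ G.degree c₄ = 5) ∨ ∃ e, IsTurn G z a e b₁ (3 - x₀))) ∨
    (1 < x₃ ∧ ∃ e, IsTurn G z a e b₁ (3 - x₀)) := by
  cases h with
  | right₁ _ h₁ h₂ h₃ _ d₁ d₂ h => exact .inl ⟨h₁, h₂, h₃, d₁, d₂, h⟩
  | right₂ _ _ _ h₃ _ h => exact .inr ⟨h₃, h⟩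
  | spread | closed | left₁ | left₂ => linarith

/-- No face at `a` is a triangle: the angles of the eight corners next to `a` are too large. -/
theorem IsFan₄.false_of_no_triangle (hz : IsPennyDrawing G z)
    (ha : IsFan₄ G z a b₁ b₂ b₃ b₄ g₁ g₂ g₃ g₄) (H : ∀ b, G.Adj a b → HasNeighborType G z a b)
    (hg₁ : 1 < g₁) (hg₂ : 1 < g₂) (hg₃ : 1 < g₃) (hg₄ : 1 < g₄) : False := by
  have key : ∀ {b₁ b₂ b₃ b₄ : V} {g₁ g₂ g₃ g₄ : ℝ}, IsFan₄ G z a b₁ b₂ b₃ b₄ g₁ g₂ g₃ g₄ →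
      1 < g₁ → 1 < g₄ → 3 < g₄ + g₁ := by
    intro b₁ b₂ b₃ b₄ g₁ g₂ g₃ g₄ ha hg₁ hg₄
    obtain ⟨c₁, c₂, c₃, c₄, x₀, x₁, x₂, x₃, x₄, hb, ht⟩ := H b₁ ha.turn₁.adj_left
    obtain ⟨-, hx₄, hl⟩ := (ha.left_face hz hb).resolve_left fun h => hg₁.ne' h.1
    obtain ⟨-, hx₀, hr⟩ := (ha.right_face hz hb).resolve_left fun h => hg₄.ne' h.1
    obtain ⟨hx₁, hx₂, hx₃, -⟩ := ht.of_one_lt hx₀ hx₄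
    linarith [hb.sum]
  have k₁ := key ha hg₁ hg₄
  have k₃ := key ha.rotate.rotate hg₃ hg₂
  linarith [ha.sum]

/-- Exactly one face at `a` is a triangle. The opposite face can only be a rhombus, and there is
no room for its far vertex. -/
theorem IsFan₄.false_of_one_triangle (hz : IsPennyDrawing G z)
    (ha : IsFan₄ G z a b₁ b₂ b₃ b₄ g₁ g₂ g₃ g₄) (H : ∀ b, G.Adj a b → HasNeighborType G z a b)
    (hg₁ : g₁ = 1) (hg₂ : 1 < g₂) (hg₃ : 1 < g₃) (hg₄ : 1 < g₄) : False := by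
  obtain ⟨c₁, c₂, c₃, c₄, x₀, x₁, x₂, x₃, x₄, hb, hbt⟩ := H b₃ ha.turn₃.adj_left
  obtain ⟨d₁, d₂, d₃, d₄, y₀, y₁, y₂, y₃, y₄, hd, hdt⟩ := H b₄ ha.turn₄.adj_left
  have ha₃ := ha.rotate.rotate
  have ha₄ := ha₃.rotate
  obtain ⟨-, hx₄, hl⟩ := (ha₃.left_face hz hb).resolve_left fun h => hg₃.ne' h.1
  obtain ⟨-, hx₀, hr⟩ := (ha₃.right_face hz hb).resolve_left fun h => hg₂.ne' h.1
  obtain ⟨-, hy₄, hl'⟩ := (ha₄.left_face hz hd).resolve_left fun h => hg₄.ne' h.1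
  obtain ⟨-, hy₀, hr'⟩ := (ha₄.right_face hz hd).resolve_left fun h => hg₃.ne' h.1
  obtain ⟨hx₁, hx₂, hx₃, -, -, dc₃, dc₄⟩ := hbt.of_one_lt hx₀ hx₄
  obtain ⟨hy₁, hy₂, hy₃, -, dd₂, -, -⟩ := hdt.of_one_lt hy₀ hy₄
  have hs := ha.sum
  have hbs := hb.sum
  have hds := hd.sum
  rcases ha.turn₃.pentagon hz hb.turn₄ hd.turn₀ hx₄ hy₀ with h | ⟨h, h', rfl⟩
  · linarith
  · obtain ⟨s, s', hs1, hs2, hsum, hS, hS'⟩ := exists_angles_opposite hz hb hd ha.turn₃ h hx₃ hx₂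
      hy₁ hy₂ hx₄ dc₄ dc₃ dd₂
    have es : s = 1 := by
      by_contra hne
      have := (hS (lt_of_le_of_ne hs1 (Ne.symm hne))).1
      linarith
    have es' : s' = 1 := by
      by_contra hne
      have := (hS' (lt_of_le_of_ne hs2 (Ne.symm hne))).1
      linarith
    linarith

/-- Exactly two faces at `a` are triangles, and they are adjacent. Then the other two faces would
be rhombi, with too small angles at `a`. -/
theorem IsFan₄.false_of_two_adjacent (hz : IsPennyDrawing G z)
    (ha : IsFan₄ G z a b₁ b₂ b₃ b₄ g₁ g₂ g₃ g₄) (H : ∀ b, G.Adj a b → HasNeighborType G z a b)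
    (hg₁ : g₁ = 1) (hg₂ : g₂ = 1) (hg₃ : 1 < g₃) (hg₄ : 1 < g₄) : False := by
  obtain ⟨c₁, c₂, c₃, c₄, x₀, x₁, x₂, x₃, x₄, h₂, ht₂⟩ := H b₂ ha.turn₂.adj_left
  obtain ⟨d₁, d₂, d₃, d₄, w₀, w₁, w₂, w₃, w₄, h₁, ht₁⟩ := H b₁ ha.turn₁.adj_left
  obtain ⟨f₁, f₂, f₃, f₄, v₀, v₁, v₂, v₃, v₄, h₃, ht₃⟩ := H b₃ ha.turn₃.adj_left
  have ha₂ := ha.rotate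
  have ha₃ := ha₂.rotate
  obtain ⟨-, hx₄, rfl⟩ := (ha₂.left_face hz h₂).resolve_right fun h => h.1.ne' hg₂
  obtain ⟨-, hx₀, rfl⟩ := (ha₂.right_face hz h₂).resolve_right fun h => h.1.ne' hg₁
  obtain ⟨-, hw₄, rfl⟩ := (ha.left_face hz h₁).resolve_right fun h => h.1.ne' hg₁
  obtain ⟨-, hw₀, -⟩ := (ha.right_face hz h₁).resolve_left fun h => hg₄.ne' h.1
  obtain ⟨-, hv₄, -⟩ := (ha₃.left_face hz h₃).resolve_left fun h => hg₃.ne' h.1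
  obtain ⟨-, hv₀, rfl⟩ := (ha₃.right_face hz h₃).resolve_right fun h => h.1.ne' hg₂
  obtain ⟨hx₁, hx₃⟩ := ht₂.of_eq_one hx₀ hx₄
  obtain ⟨-, ⟨-, hx₁'⟩, -, ⟨-, hx₃'⟩, -⟩ := h₂.bounds hz
  have r₁ : g₄ < 2 := by
    rcases ht₁.of_right hw₀ hw₄ with ⟨-, -, rfl, -⟩ | ⟨-, e, he⟩
    · have := (h₂.turn₁.unique_right hz (h₁.turn₃.triangle' hz) hx₁' (by norm_num)).2
      linarith
    · linarith [(ha.prev_unique hz he (by linarith)).2]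
  have r₃ : g₃ < 2 := by
    rcases ht₃.of_left hv₀ hv₄ with ⟨rfl, -⟩ | ⟨-, e, he⟩
    · have := (h₂.turn₃.unique_left hz (h₃.turn₁.triangle hz) hx₃' (by norm_num)).2
      linarith
    · linarith [(ha₃.next_unique hz he (by linarith)).2]
  linarith [ha.sum]

/-- Exactly two faces at `a` are triangles, and they are opposite, with `g₄ < g₂`. The large face
of angle `g₂` is not a rhombus. The faces of angles `g₂` and `g₄` cannot both have at least five
vertices, because the tips of the triangles at `b₁ b₂` and `b₃ b₄` leave too little room. Hence the
face of angle `g₄` is a rhombus, whose far vertex forces another rhombus and three collinear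
points. -/
theorem IsFan₄.false_of_two_opposite_of_lt (hz : IsPennyDrawing G z)
    (ha : IsFan₄ G z a b₁ b₂ b₃ b₄ g₁ g₂ g₃ g₄) (H : ∀ b, G.Adj a b → HasNeighborType G z a b)
    (hg₁ : g₁ = 1) (hg₃ : g₃ = 1) (hg₄ : 1 < g₄) (hlt : g₄ < g₂) : False := by
  obtain ⟨d₁, d₂, d₃, d₄, w₀, w₁, w₂, w₃, w₄, h₁, ht₁⟩ := H b₁ ha.turn₁.adj_left
  obtain ⟨c₁, m, c₃, c₄, x₀, x₁, x₂, x₃, x₄, h₂, ht₂⟩ := H b₂ ha.turn₂.adj_left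
  obtain ⟨f₁, f₂, n, f₄, y₀, y₁, y₂, y₃, y₄, h₃, ht₃⟩ := H b₃ ha.turn₃.adj_left
  obtain ⟨k₁, k₂, k₃, k₄, v₀, v₁, v₂, v₃, v₄, h₄, ht₄⟩ := H b₄ ha.turn₄.adj_left
  have hs := ha.sum
  have hg₂ : 2 < g₂ := by linarith
  have hg₄' : g₄ < 2 := by linarith
  have ha₂ := ha.rotate
  have ha₃ := ha₂.rotate
  have ha₄ := ha₃.rotate
  obtain ⟨-, hw₄, rfl⟩ := (ha.left_face hz h₁).resolve_right fun h => h.1.ne' hg₁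
  obtain ⟨-, hw₀, hr₁⟩ := (ha.right_face hz h₁).resolve_left fun h => hg₄.ne' h.1
  obtain ⟨-, hx₄, -⟩ := (ha₂.left_face hz h₂).resolve_left fun h => by linarith [h.1]
  obtain ⟨-, hx₀, rfl⟩ := (ha₂.right_face hz h₂).resolve_right fun h => h.1.ne' hg₁
  obtain ⟨-, hy₄, rfl⟩ := (ha₃.left_face hz h₃).resolve_right fun h => h.1.ne' hg₃
  obtain ⟨-, hy₀, -⟩ := (ha₃.right_face hz h₃).resolve_left fun h => by linarith [h.1]
  obtain ⟨-, hv₄, hl₄⟩ := (ha₄.left_face hz h₄).resolve_left fun h => hg₄.ne' h.1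
  obtain ⟨-, hv₀, rfl⟩ := (ha₄.right_face hz h₄).resolve_right fun h => h.1.ne' hg₃
  have no₂ : ¬∃ e, IsTurn G z a d₄ e (3 - x₄) := by
    rintro ⟨e, he⟩
    linarith [(ha₂.next_unique hz he (by linarith)).2]
  have no₃ : ¬∃ e, IsTurn G z a e k₁ (3 - y₀) := by
    rintro ⟨e, he⟩
    linarith [(ha₃.prev_unique hz he (by linarith)).2]
  obtain ⟨hx₁, hx₂, hx₃, -, -, hd⟩ := (ht₂.of_left hx₀ hx₄).resolve_right fun h => no₂ h.2
  obtain ⟨-, dm⟩ := hd.resolve_right no₂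
  obtain ⟨hy₁, hy₂, hy₃, -, -, hd⟩ := (ht₃.of_right hy₀ hy₄).resolve_right fun h => no₃ h.2
  obtain ⟨dn, -⟩ := hd.resolve_right no₃
  subst hx₁ hy₃
  -- The second triangles at `b₂` and `b₃` are shared with `b₁` and `b₄`.
  obtain ⟨-, -, -, ⟨-, hw₃'⟩, -⟩ := h₁.bounds hz
  obtain ⟨-, ⟨-, hv₁'⟩, -⟩ := h₄.bounds hz
  obtain ⟨rfl, hw₃⟩ := h₁.turn₃.unique_left hz (h₂.turn₁.triangle hz) hw₃' (by norm_num)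
  obtain ⟨rfl, hv₁⟩ := h₄.turn₁.unique_right hz (h₃.turn₃.triangle' hz) hv₁' (by norm_num)
  obtain ⟨hw₁, hw₂, -, dd₁, dd₂, -⟩ := (ht₁.of_right hw₀ hw₄).resolve_right fun h => h.1.ne' hw₃
  obtain ⟨-, hv₂, hv₃, dk₃, dk₄, -⟩ := (ht₄.of_left hv₀ hv₄).resolve_right fun h => h.1.ne' hv₁
  have tip₁ := add_le_three_of_tip hz h₂ h₁ dm hx₀ rfl hx₂ hx₃ hw₁ hw₂ hw₃ hw₄
  have tip₂ := add_le_three_of_tip hz h₄ h₃ dn hv₀ hv₁ hv₂ hv₃ hy₁ hy₂ rfl hy₄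
  have large : 5 < g₂ + x₄ + y₀ := by
    rcases ha.turn₂.pentagon hz h₂.turn₄ h₃.turn₀ hx₄ hy₀ with h | h
    · exact h
    · linarith [h.1]
  rcases ha.turn₄.pentagon hz h₄.turn₄ h₁.turn₀ hv₄ hw₀ with h | ⟨h, h', rfl⟩
  · linarith
  obtain ⟨s, s', hs1, hs2, hsum, hS, hS'⟩ := exists_angles_opposite hz h₄ h₁ ha.turn₄ h hv₃ hv₂
    hw₁ hw₂ hv₄ dk₄ dk₃ dd₂
  have s₁ := h₁.sum
  have s₄ := h₄.sum
  have hq := ha.turn₄.rhombus h₄.turn₄ h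
  subst hg₁ hg₃
  by_cases es : s = 1
  · by_cases es' : s' = 1
    · linarith
    · obtain ⟨p, p'⟩ := hS' (lt_of_le_of_ne hs2 (Ne.symm es'))
      obtain ⟨e, he⟩ := p' (by linarith)
      refine false_of_rhombi hz.mirror (e := e) ha.turn₃.mirror ha.turn₄.mirror h₁.mirror hg₄' hw₄
        hw₃ hw₁ ?_ ?_
      · rw [hq, map_sub, map_add]; ring
      · rw [he]; simp
  · obtain ⟨p, p'⟩ := hS (lt_of_le_of_ne hs1 (Ne.symm es))
    obtain ⟨e, he⟩ := p' (by linarith)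
    exact false_of_rhombi hz ha.turn₁ ha.turn₄ h₄ hg₄' hv₀ hv₁ hv₃ hq he

theorem IsFan₄.false_of_two_opposite (hz : IsPennyDrawing G z)
    (ha : IsFan₄ G z a b₁ b₂ b₃ b₄ g₁ g₂ g₃ g₄) (H : ∀ b, G.Adj a b → HasNeighborType G z a b)
    (hg₁ : g₁ = 1) (hg₂ : 1 < g₂) (hg₃ : g₃ = 1) (hg₄ : 1 < g₄) : False := by
  rcases lt_trichotomy g₄ g₂ with h | h | h
  · exact ha.false_of_two_opposite_of_lt hz H hg₁ hg₃ hg₄ h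
  · exact (ha.turn₁.trans ha.turn₂).ne_three hz (by linarith [ha.sum])
  · exact ha.rotate.rotate.false_of_two_opposite_of_lt hz H hg₃ hg₁ hg₂ h

theorem IsFan₄.false_of_hasNeighborType (hz : IsPennyDrawing G z)
    (ha : IsFan₄ G z a b₁ b₂ b₃ b₄ g₁ g₂ g₃ g₄) (H : ∀ b, G.Adj a b → HasNeighborType G z a b) :
    False := by
  have ne : g₁ ≠ 3 ∧ g₂ ≠ 3 ∧ g₃ ≠ 3 ∧ g₄ ≠ 3 :=
    ⟨ha.turn₁.ne_three hz, ha.turn₂.ne_three hz, ha.turn₃.ne_three hz, ha.turn₄.ne_three hz⟩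
  obtain ⟨n₁, n₂, n₃, n₄⟩ := ne
  have hs := ha.sum
  have ha₂ := ha.rotate
  have ha₃ := ha₂.rotate
  have ha₄ := ha₃.rotate
  rcases eq_or_lt_of_le' ha.turn₁.one_le with h₁ | h₁ <;>
    rcases eq_or_lt_of_le' ha.turn₂.one_le with h₂ | h₂ <;>
    rcases eq_or_lt_of_le' ha.turn₃.one_le with h₃ | h₃ <;>
    rcases eq_or_lt_of_le' ha.turn₄.one_le with h₄ | h₄
  -- Three triangles in a row would leave a straight angle for the fourth face.
  · linarith
  · exact n₄ (by linarith)
  · exact n₃ (by linarith)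
  · exact ha.false_of_two_adjacent hz H h₁ h₂ h₃ h₄
  · exact n₂ (by linarith)
  · exact ha.false_of_two_opposite hz H h₁ h₂ h₃ h₄
  · exact ha₄.false_of_two_adjacent hz H h₄ h₁ h₂ h₃
  · exact ha.false_of_one_triangle hz H h₁ h₂ h₃ h₄
  · exact n₁ (by linarith)
  · exact ha₂.false_of_two_adjacent hz H h₂ h₃ h₄ h₁
  · exact ha₂.false_of_two_opposite hz H h₂ h₃ h₄ h₁
  · exact ha₂.false_of_one_triangle hz H h₂ h₃ h₄ h₁
  · exact ha₃.false_of_two_adjacent hz H h₃ h₄ h₁ h₂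
  · exact ha₃.false_of_one_triangle hz H h₃ h₄ h₁ h₂
  · exact ha₄.false_of_one_triangle hz H h₄ h₁ h₂ h₃
  · exact ha.false_of_no_triangle hz H h₁ h₂ h₃ h₄

end Faces

end Main

/-! ### From the Euclidean plane to the complex plane -/

/-- The plane of the drawing, identified with `ℂ`. -/
theorem IsPennyGraph.isPennyDrawing {V : Type*} {G : SimpleGraph V} {p : V → Plane}
    (hG : IsPennyGraph G p) (hp : InGeneralPosition p) :
    IsPennyDrawing G (fun v => (⟨p v 0, p v 1⟩ : ℂ)) := by
  have hd : ∀ u v, dist (p u) (p v) = ‖(⟨p u 0, p u 1⟩ : ℂ) - ⟨p v 0, p v 1⟩‖ := by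
    intro u v
    rw [EuclideanSpace.dist_eq, Fin.sum_univ_two, Complex.norm_def, Complex.normSq_apply]
    simp only [Real.dist_eq, sq_abs, Complex.sub_re, Complex.sub_im, ← sq]
  refine ⟨fun u v huv => ?_, fun u v => ?_, fun u v w huv huw hvw him => ?_⟩
  · rw [← hd]; exact hG.one_le_dist u v huv
  · rw [← hd]; exact hG.adj_iff u v
  · apply hp u v w huv huw hvw
    simp only [Complex.mul_im, Complex.sub_re, Complex.sub_im, Complex.conj_re, Complex.conj_im]
      at him
    have hne : p v ≠ p u := by
      intro h
      have := hG.one_le_dist u v huv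
      rw [h, dist_self] at this
      linarith
    rw [collinear_iff_of_mem (p₀ := p u) (by simp)]
    have hne' : (p v 0 - p u 0) ^ 2 + (p v 1 - p u 1) ^ 2 ≠ 0 := by
      intro h0
      apply hne
      ext i
      fin_cases i
      · simp only [Fin.zero_eta]; nlinarith [sq_nonneg (p v 0 - p u 0), sq_nonneg (p v 1 - p u 1)]
      · simp only [Fin.mk_one]; nlinarith [sq_nonneg (p v 0 - p u 0), sq_nonneg (p v 1 - p u 1)]
    refine ⟨p v - p u, ?_⟩
    simp only [Set.mem_insert_iff, Set.mem_singleton_iff, forall_eq_or_imp, forall_eq]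
    refine ⟨⟨0, by simp⟩, ⟨1, by simp⟩,
      ⟨((p w 0 - p u 0) * (p v 0 - p u 0) + (p w 1 - p u 1) * (p v 1 - p u 1)) /
        ((p v 0 - p u 0) ^ 2 + (p v 1 - p u 1) ^ 2), ?_⟩⟩
    ext i
    fin_cases i
    · simp only [Fin.zero_eta, vadd_eq_add, PiLp.add_apply, PiLp.smul_apply, PiLp.sub_apply,
        smul_eq_mul]
      field_simp
      linear_combination (p v 1 - p u 1) * him
    · simp only [Fin.mk_one, vadd_eq_add, PiLp.add_apply, PiLp.smul_apply, PiLp.sub_apply,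
        smul_eq_mul]
      field_simp
      linear_combination -(p v 0 - p u 0) * him

theorem theorem4 {V : Type*} [Fintype V] (G : SimpleGraph V) [DecidableRel G.Adj]
    (p : V → Plane) (hG : IsPennyGraph G p) (hp : InGeneralPosition p)
    (a : V) (ha : G.degree a = 4) :
    ∃ b : V, G.Adj a b ∧ ¬ IsPopular G b ∧ ¬ BelongsToKernel G b := by
  have hz := hG.isPennyDrawing hp
  obtain ⟨b₁, b₂, b₃, b₄, g₁, g₂, g₃, g₄, hf⟩ := hz.exists_fan₄ ha
  by_contra! hcon
  refine hf.false_of_hasNeighborType hz fun b hab => ?_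
  by_cases hb : IsPopular G b
  · exact hasNeighborType_of_isPopular hz ha hab hb
  · exact hasNeighborType_of_kernel hz ha hab (hcon b hab hb)
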